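/- Let $n\ge2$ and $m\ge1$ be integers, and let $0<\alpha\le2$, $-\infty<\sigma<n$, $0<q<\infty$ and $0<p<\infty$ be real, with moreover $p\ge1$ if $\alpha=2$. For $\alpha=2$ let $(-\Delta)^{\alpha/2}=-\Delta$; for $0<\alpha<2$ let $$(-\Delta)^{\alpha/2}u(x)=C_{\alpha,n}\lim_{\epsilon\to0^+}\int_{|y-x|\ge\epsilon}\frac{u(x)-u(y)}{|x-y|^{n+\alpha}}\,dy,\qquad C_{\alpha,n}=\Big(\int_{\mathbb{R}^n}\frac{1-\cos(2\pi\zeta_1)}{|\zeta|^{n+\alpha}}\,d\zeta\Big)^{-1},$$ and put $(-\Delta)^{i+\alpha/2}u:=(-\Delta)^i\big((-\Delta)^{\alpha/2}u\big)$ for integers $i\ge0$. Let $u:\mathbb{R}^n\to[0,\infty)$ be a nonnegative classical solution of $$(-\Delta)^{m+\alpha/2}u(x)=\Big(\int_{\mathbb{R}^n}\frac{|u(y)|^p}{|x-y|^{\sigma}}\,dy\Big)\,u(x)^q\qquad\text{in }\mathbb{R}^n;$$ that is, $u\in C^{2m+2}(\mathbb{R}^n)$ if $\alpha=2$; if $0<\alpha<2$,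 then $\int_{\mathbb{R}^n}\frac{|u(x)|}{1+|x|^{n+\alpha}}\,dx<\infty$ and there is $\epsilon>0$ with $\{\alpha\}+\epsilon\le1$ such that $u\in C^{2m+[\alpha],\{\alpha\}+\epsilon}_{loc}(\mathbb{R}^n)$ (the derivatives of order $2m+[\alpha]$ exist, are continuous, and are Hölder continuous with exponent $\{\alpha\}+\epsilon$ on every compact set), where $[\alpha]$ is the integer part of $\alpha$ and $\{\alpha\}=\alpha-[\alpha]$; and for every $x\in\mathbb{R}^n$ the integral on the right-hand side is finite and the equation holds at $x$. Then, for every $i=0,1,\dots,m-1$, $$(-\Delta)^{i+\frac{\alpha}{2}}u(x)\ge0\qquad\text{for all }x\in\mathbb{R}^n.$$ -/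

import Mathlib

open MeasureTheory Filter Topology
open scoped NNReal

noncomputable section

namespace SuperPolyharmonic

/-- The constant `C_{α,n} = (∫ (1 - cos (2π ζ₁)) / |ζ|^(n+α) dζ)⁻¹`; the first coordinate `ζ₁` is
`ζ 0`, which is why `n ≠ 0` is needed. -/
def fracConst (n : ℕ) [NeZero n] (α : ℝ) : ℝ :=
  (∫ ζ : EuclideanSpace ℝ (Fin n),
    (1 - Real.cos (2 * Real.pi * ζ 0)) / ‖ζ‖ ^ ((n : ℝ) + α))⁻¹

/-- The nonlocal fractional Laplacian, as a principal value. The limit exists at every point if `u`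
is of class `C^{[α],{α}+ε}` locally for some `ε > 0` and lies in the weighted space `WeightedL1 α`
below. -/
def fracLaplacianPV {n : ℕ} [NeZero n] (α : ℝ) (u : EuclideanSpace ℝ (Fin n) → ℝ)
    (x : EuclideanSpace ℝ (Fin n)) : ℝ :=
  fracConst n α *
    limUnder (𝓝[>] (0 : ℝ)) (fun ε : ℝ =>
      ∫ y in {y : EuclideanSpace ℝ (Fin n) | ε ≤ ‖y - x‖},
        (u x - u y) / ‖x - y‖ ^ ((n : ℝ) + α))

/-- `-Δ`. -/
def negLaplacian {n : ℕ} (u : EuclideanSpace ℝ (Fin n) → ℝ) :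
    EuclideanSpace ℝ (Fin n) → ℝ :=
  fun x => -(Laplacian.laplacian u x)

/-- `(-Δ)^{α/2}` for `0 < α ≤ 2`: the classical `-Δ` for `α = 2`, the principal value integral for
`0 < α < 2`. -/
def fracLaplacian {n : ℕ} [NeZero n] (α : ℝ) (u : EuclideanSpace ℝ (Fin n) → ℝ) :
    EuclideanSpace ℝ (Fin n) → ℝ :=
  if α = 2 then negLaplacian u else fracLaplacianPV α u

/-- `(-Δ)^{i + α/2} u = (-Δ)^i ((-Δ)^{α/2} u)`. -/
def higherFracLaplacian {n : ℕ} [NeZero n] (i : ℕ) (α : ℝ)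
    (u : EuclideanSpace ℝ (Fin n) → ℝ) : EuclideanSpace ℝ (Fin n) → ℝ :=
  negLaplacian^[i] (fracLaplacian α u)

/-- The space `𝓛_α(ℝⁿ)`: the integral of `|u(x)| / (1 + |x|^(n+α))` is finite. -/
def WeightedL1 {n : ℕ} (α : ℝ) (u : EuclideanSpace ℝ (Fin n) → ℝ) : Prop :=
  Integrable (fun x => |u x| / (1 + ‖x‖ ^ ((n : ℝ) + α)))

/-- The local Hölder space `C^{k,γ}_loc(ℝⁿ)`: `u` is `C^k` and its derivative of order `k` is Hölder
continuous with exponent `γ` on every compact set. -/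
def LocHolder {n : ℕ} (k : ℕ) (γ : ℝ≥0) (u : EuclideanSpace ℝ (Fin n) → ℝ) : Prop :=
  ContDiff ℝ k u ∧
    ∀ K : Set (EuclideanSpace ℝ (Fin n)), IsCompact K →
      ∃ C : ℝ≥0, HolderOnWith C γ (iteratedFDeriv ℝ k u) K

/-- The regularity of a classical solution of an equation of order `2m + α`: `C^{2m+2}` if `α = 2`;
if `0 < α < 2`, then `u ∈ 𝓛_α(ℝⁿ)` and `u` is of class `C^{2m+[α],{α}+ε}` locally for some `ε > 0`,
as small as one likes. -/
def ClassicalRegularity {n : ℕ} (m : ℕ) (α : ℝ) (u : EuclideanSpace ℝ (Fin n) → ℝ) : Prop :=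
  (α = 2 → ContDiff ℝ ((2 * m + 2 : ℕ) : WithTop ℕ∞) u) ∧
  (α < 2 → WeightedL1 α u ∧
    ∃ ε : ℝ, 0 < ε ∧ Int.fract α + ε ≤ 1 ∧
      LocHolder (2 * m + ⌊α⌋₊) (Int.fract α + ε).toNNReal u)

/-- Nonnegative classical solutions of
`(-Δ)^{m+α/2} u = (|x|^{-σ} * |u|^p) u^q` on `ℝⁿ`. The equation holds at every point, the convolution
being a convergent integral. -/
structure IsNonnegClassicalSolution {n : ℕ} [NeZero n] (m : ℕ) (α σ p q : ℝ)
    (u : EuclideanSpace ℝ (Fin n) → ℝ) : Prop where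
  nonneg : ∀ x, 0 ≤ u x
  regular : ClassicalRegularity m α u
  conv_finite : ∀ x, Integrable (fun y => 1 / ‖x - y‖ ^ σ * |u y| ^ p)
  eqn : ∀ x, higherFracLaplacian m α u x =
    (∫ y, 1 / ‖x - y‖ ^ σ * |u y| ^ p) * u x ^ q

end SuperPolyharmonic

end

/-!
The proof rests on the means of a function at large scales. Say that `w` has vanishing means
(`VanishingMeans`) if `∫ w (x₀ + R z) φ z dz → 0` as `R → ∞` for every test function `φ` and every
centre `x₀`. Two facts make this notion useful.

* If `w` is `C²` with vanishing means, so is `-Δ w`: Green's identity moves the Laplacian to `φ`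
  and gains a factor `R⁻²` (`VanishingMeans.neg_laplacian`).
* If moreover `-Δ w ≥ 0`, then `w ≥ 0`: for a suitable radial weight `φ ≥ 0` the means of a
  superharmonic function decrease in `R`, from `w x₀ ∫ φ` at `R = 0` to the limit `0`
  (`VanishingMeans.nonneg_of_laplacian_nonpos`).

Hence, if `W = (-Δ)^{α/2} u` is of class `C^{2m}` with vanishing means and `(-Δ)^m W ≥ 0`,
descending induction gives `(-Δ)^i W ≥ 0` for all `i ≤ m` (`VanishingMeans.iterate_negLaplacian_nonneg`). The
sign of `(-Δ)^m W` is read off from the equation, so only the regularity and the vanishing means of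
`W` remain.

For `α = 2` the regularity is given. The function `u` itself has vanishing means: since `p ≥ 1` and
`σ < n`, the convergence of `∫ |u|^p |x - y|^{-σ} dy` makes the means of `|u|^p` over large balls
tend to zero (`vanishingMeans_of_integrable_rpow`).

For `0 < α < 2` put `β = n + α`. The principal value is a multiple of the absolutely convergent
integral `T u x = ∫ ‖z‖^(-β) (2 u x - u (x + z) - u (x - z)) dz`
(`NonlocalDomain.tendsto_truncated`). A smooth splitting of the kernel shows that `T u` is `C^{2m}`: near the singularity the derivatives
fall on `u`, away from it they fall on the kernel (`contDiff_singularIntegral`). By Fubini `T` is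
symmetric, and `T φ` decays like `‖x‖^(-β)`; after rescaling, the mean of `T u` at scale `R` is
bounded by a multiple of `∫ |u x| / (R^β + ‖x - x₀‖^β) dx`, which tends to zero because `u` lies in the
weighted space (`NonlocalDomain.vanishingMeans_singularIntegral`).
-/

namespace SuperPolyharmonic

noncomputable section

open Module Laplacian
open scoped ContDiff

/-! ### Green's identities and vanishing means -/

section LaplacianCalculus

variable {E : Type*} [NormedAddCommGroup E] [InnerProductSpace ℝ E]

theorem contDiff_fderiv_apply {k : ℕ} {f : E → ℝ} (hf : ContDiff ℝ (k + 1 : ℕ) f) (v : E) :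
    ContDiff ℝ k (fun y => fderiv ℝ f y v) :=
  (hf.fderiv_right (m := k) (by norm_cast)).clm_apply contDiff_const

theorem fderiv_comp_add_smul {F : Type*} [NormedAddCommGroup F] [NormedSpace ℝ F] {f : E → F}
    (hf : Differentiable ℝ f) (x₀ : E) (R : ℝ) (z : E) :
    fderiv ℝ (fun z => f (x₀ + R • z)) z = R • fderiv ℝ f (x₀ + R • z) := by
  have h : HasFDerivAt (fun z : E => x₀ + R • z) (R • ContinuousLinearMap.id ℝ E) z :=
    ((hasFDerivAt_id z).const_smul R).const_add x₀
  have := ((hf (x₀ + R • z)).hasFDerivAt.comp z h).fderiv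
  rw [show (fun z => f (x₀ + R • z)) = f ∘ fun z => x₀ + R • z from rfl, this]
  ext v; simp

variable [FiniteDimensional ℝ E]

theorem laplacian_eq_sum_fderiv {f : E → ℝ} (hf : ContDiff ℝ 2 f) (x : E) :
    laplacian f x = ∑ i, fderiv ℝ (fun y => fderiv ℝ f y (stdOrthonormalBasis ℝ E i)) x
      (stdOrthonormalBasis ℝ E i) := by
  rw [InnerProductSpace.laplacian_eq_iteratedFDeriv_stdOrthonormalBasis]
  refine Finset.sum_congr rfl fun i _ => ?_
  rw [iteratedFDeriv_two_apply, fderiv_clm_apply]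
  · simp
  · exact ((hf.fderiv_right (m := 1) (by norm_num)).differentiable (by norm_num)) x
  · fun_prop

theorem contDiff_laplacian {k : ℕ} {f : E → ℝ} (hf : ContDiff ℝ (k + 2 : ℕ) f) :
    ContDiff ℝ k (laplacian f) := by
  have h2 : ContDiff ℝ 2 f := hf.of_le (by norm_cast; omega)
  rw [show laplacian f = _ from funext (laplacian_eq_sum_fderiv h2)]
  exact ContDiff.sum fun i _ => contDiff_fderiv_apply (contDiff_fderiv_apply (k := k + 1) hf _) _

theorem laplacian_comp_add_smul {f : E → ℝ} (hf : ContDiff ℝ 2 f) (x₀ : E) (R : ℝ) (z : E) :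
    laplacian (fun z => f (x₀ + R • z)) z = R ^ 2 * laplacian f (x₀ + R • z) := by
  have hd : Differentiable ℝ f := hf.differentiable (by norm_num)
  rw [laplacian_eq_sum_fderiv (by fun_prop), laplacian_eq_sum_fderiv hf, Finset.mul_sum]
  refine Finset.sum_congr rfl fun i _ => ?_
  have hd' : Differentiable ℝ (fun y => fderiv ℝ f y (stdOrthonormalBasis ℝ E i)) :=
    (contDiff_fderiv_apply (k := 1) hf _).differentiable (by norm_num)
  have : (fun y => fderiv ℝ (fun z => f (x₀ + R • z)) y (stdOrthonormalBasis ℝ E i)) =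
      fun y => R * (fun y => fderiv ℝ f y (stdOrthonormalBasis ℝ E i)) (x₀ + R • y) := by
    ext y; rw [fderiv_comp_add_smul hd]; simp
  have hd2 : Differentiable ℝ
      fun y => (fun y => fderiv ℝ f y (stdOrthonormalBasis ℝ E i)) (x₀ + R • y) :=
    hd'.comp (by fun_prop)
  rw [this, fderiv_const_mul (hd2 z), fderiv_comp_add_smul hd']
  simp only [_root_.smul_apply, smul_eq_mul]
  ring

theorem hasCompactSupport_laplacian {g : E → ℝ} (hgs : HasCompactSupport g) :
    HasCompactSupport (laplacian g) := by
  refine hgs.mono' fun x hx => ?_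
  contrapose! hx
  have : g =ᶠ[𝓝 x] fun _ => 0 := notMem_tsupport_iff_eventuallyEq.1 hx
  simp [InnerProductSpace.laplacian_congr_nhds this |>.eq_of_nhds]

variable [MeasurableSpace E] [BorelSpace E]

theorem integral_fderiv_apply_mul {f g : E → ℝ} (hf : ContDiff ℝ 1 f) (hg : ContDiff ℝ 1 g)
    (hgs : HasCompactSupport g) (v : E) :
    ∫ x, fderiv ℝ f x v * g x = -∫ x, f x * fderiv ℝ g x v := by
  have hf' : Continuous fun x => fderiv ℝ f x v := (contDiff_fderiv_apply (k := 0) hf v).continuous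
  have hg' : Continuous fun x => fderiv ℝ g x v := (contDiff_fderiv_apply (k := 0) hg v).continuous
  have hgs' : HasCompactSupport fun x => fderiv ℝ g x v := hgs.fderiv_apply ℝ v
  rw [integral_mul_fderiv_eq_neg_fderiv_mul_of_integrable, neg_neg]
  · exact (hf'.mul hg.continuous).integrable_of_hasCompactSupport hgs.mul_left
  · exact (hf.continuous.mul hg').integrable_of_hasCompactSupport hgs'.mul_left
  · exact (hf.continuous.mul hg.continuous).integrable_of_hasCompactSupport hgs.mul_left
  · exact fun x _ => hf.differentiable (by norm_num) x
  · exact fun x _ => hg.differentiable (by norm_num) x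

/-- Green's first identity against a compactly supported function. -/
theorem integral_laplacian_mul {f g : E → ℝ} (hf : ContDiff ℝ 2 f) (hg : ContDiff ℝ 1 g)
    (hgs : HasCompactSupport g) :
    ∫ x, laplacian f x * g x = -∑ i, ∫ x, fderiv ℝ f x (stdOrthonormalBasis ℝ E i) *
      fderiv ℝ g x (stdOrthonormalBasis ℝ E i) := by
  have hc (i) := contDiff_fderiv_apply (k := 1) hf (stdOrthonormalBasis ℝ E i)
  simp_rw [laplacian_eq_sum_fderiv hf, Finset.sum_mul]
  rw [integral_finsetSum, ← Finset.sum_neg_distrib]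
  · exact Finset.sum_congr rfl fun i _ => integral_fderiv_apply_mul (hc i) hg hgs _
  · exact fun i _ => ((contDiff_fderiv_apply (k := 0) (hc i) _).continuous.mul
      hg.continuous).integrable_of_hasCompactSupport hgs.mul_left

/-- Green's second identity against a compactly supported function. -/
theorem integral_laplacian_mul_comm {f g : E → ℝ} (hf : ContDiff ℝ 2 f) (hg : ContDiff ℝ 2 g)
    (hgs : HasCompactSupport g) :
    ∫ x, laplacian f x * g x = ∫ x, f x * laplacian g x := by
  have hc (i) := contDiff_fderiv_apply (k := 1) hg (stdOrthonormalBasis ℝ E i)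
  rw [integral_laplacian_mul hf (hg.of_le (by norm_num)) hgs, ← Finset.sum_neg_distrib]
  simp_rw [laplacian_eq_sum_fderiv hg, Finset.mul_sum]
  rw [integral_finsetSum]
  · refine Finset.sum_congr rfl fun i _ => ?_
    rw [integral_fderiv_apply_mul (hf.of_le (by norm_num)) (hc i) (hgs.fderiv_apply ℝ _), neg_neg]
  · exact fun i _ => (hf.continuous.mul
      (contDiff_fderiv_apply (k := 0) (hc i) _).continuous).integrable_of_hasCompactSupport
      ((hgs.fderiv_apply ℝ _).fderiv_apply ℝ _).mul_left

/-- All rescaled weighted means of `w` tend to zero at large scales: for every test function `φ`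
and every centre `x₀`, the integral of `w (x₀ + R z) φ z` tends to `0` as `R → ∞`. -/
def VanishingMeans (w : E → ℝ) : Prop :=
  ∀ φ : E → ℝ, ContDiff ℝ ∞ φ → HasCompactSupport φ → ∀ x₀ : E,
    Tendsto (fun R : ℝ => ∫ z, w (x₀ + R • z) * φ z) atTop (𝓝 0)

/-- Passing the Laplacian to the test function gains a factor `R⁻²`. -/
theorem VanishingMeans.neg_laplacian {w : E → ℝ} (hw : ContDiff ℝ 2 w) (h : VanishingMeans w) :
    VanishingMeans fun x => -laplacian w x := by
  intro φ hφ hφs x₀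
  have hφ2 : ContDiff ℝ 2 φ := contDiff_infty.1 hφ 2
  have hΔ : ContDiff ℝ ∞ (laplacian φ) :=
    contDiff_infty.2 fun k => contDiff_laplacian (contDiff_infty.1 hφ (k + 2))
  have h1 := h (laplacian φ) hΔ (hasCompactSupport_laplacian hφs) x₀
  have h2 : Tendsto (fun R : ℝ => -((R ^ 2)⁻¹ * ∫ z, w (x₀ + R • z) * laplacian φ z))
      atTop (𝓝 0) := by
    have := (((tendsto_pow_atTop (α := ℝ) two_ne_zero).inv_tendsto_atTop).mul h1).neg
    simpa using this
  refine h2.congr' ?_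
  filter_upwards [eventually_gt_atTop 0] with R hR
  rw [← integral_laplacian_mul_comm (f := fun z => w (x₀ + R • z)) (by fun_prop) hφ2 hφs]
  simp_rw [laplacian_comp_add_smul hw, mul_assoc, integral_const_mul, neg_mul, integral_neg]
  rw [inv_mul_cancel_left₀ (by positivity)]

end LaplacianCalculus

/-! ### Superharmonic functions with vanishing means -/

section MeanValue

variable {E : Type*} [NormedAddCommGroup E] [InnerProductSpace ℝ E]

/-- A smooth nonnegative radial function, positive exactly on the ball of radius `√2`. -/
def radialPotential (z : E) : ℝ := Real.smoothTransition (2 - ‖z‖ ^ 2)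

/-- The radial weight `φ ≥ 0` with `∇ (radialPotential) z = -φ z • z`. -/
def radialWeight (z : E) : ℝ := 2 * deriv Real.smoothTransition (2 - ‖z‖ ^ 2)

theorem contDiff_radialPotential : ContDiff ℝ ∞ (radialPotential : E → ℝ) :=
  Real.smoothTransition.contDiff.comp (contDiff_const.sub (contDiff_norm_sq ℝ))

theorem contDiff_radialWeight : ContDiff ℝ ∞ (radialWeight : E → ℝ) := by
  have : ContDiff ℝ ∞ (deriv Real.smoothTransition) :=
    (contDiff_infty_iff_deriv.1 Real.smoothTransition.contDiff).2
  exact contDiff_const.mul (this.comp (contDiff_const.sub (contDiff_norm_sq ℝ)))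

theorem radialWeight_nonneg {E : Type*} [NormedAddCommGroup E] (z : E) : 0 ≤ radialWeight z :=
  mul_nonneg zero_le_two Real.smoothTransition.monotone.deriv_nonneg

theorem fderiv_radialPotential (z v : E) :
    fderiv ℝ radialPotential z v = -(radialWeight z * inner ℝ z v) := by
  have h1 : HasFDerivAt (fun z : E => 2 - ‖z‖ ^ 2) (-(2 • innerSL ℝ z)) z :=
    ((hasStrictFDerivAt_norm_sq z).hasFDerivAt).const_sub 2
  have h2 : HasDerivAt Real.smoothTransition (deriv Real.smoothTransition (2 - ‖z‖ ^ 2))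
      (2 - ‖z‖ ^ 2) :=
    (Real.smoothTransition.contDiff (n := 1).differentiable (by norm_num) _).hasDerivAt
  have h3 := (h2.comp_hasFDerivAt z h1).fderiv
  rw [show (radialPotential : E → ℝ) = Real.smoothTransition ∘ fun z => 2 - ‖z‖ ^ 2 from rfl, h3]
  simp [radialWeight]
  ring

variable [FiniteDimensional ℝ E]

theorem hasCompactSupport_radialPotential : HasCompactSupport (radialPotential : E → ℝ) := by
  refine HasCompactSupport.intro (isCompact_closedBall 0 2) fun z hz => ?_
  have : 2 < ‖z‖ := by simpa using hz
  exact Real.smoothTransition.zero_of_nonpos (by nlinarith)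

theorem hasCompactSupport_radialWeight : HasCompactSupport (radialWeight : E → ℝ) := by
  refine HasCompactSupport.intro (isCompact_closedBall 0 2) fun z hz => ?_
  have hz : 2 < ‖z‖ := by simpa using hz
  have : Real.smoothTransition =ᶠ[𝓝 (2 - ‖z‖ ^ 2)] fun _ => 0 := by
    filter_upwards [Iio_mem_nhds (show 2 - ‖z‖ ^ 2 < 0 by nlinarith)] with t ht
    exact Real.smoothTransition.zero_of_nonpos (le_of_lt ht)
  simp [radialWeight, this.deriv_eq]

variable [MeasurableSpace E] [BorelSpace E]

theorem integral_radialWeight_pos [Nontrivial E] : 0 < ∫ z : E, radialWeight z := by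
  obtain ⟨t, ht, hts⟩ := exists_deriv_eq_slope Real.smoothTransition zero_lt_one
    Real.smoothTransition.continuous.continuousOn
    (Real.smoothTransition.contDiff (n := 1).differentiable (by norm_num)).differentiableOn
  obtain ⟨z, hz⟩ := exists_norm_eq E (Real.sqrt_nonneg (2 - t))
  refine contDiff_radialWeight.continuous.integral_pos_of_hasCompactSupport_nonneg_nonzero
    hasCompactSupport_radialWeight radialWeight_nonneg (x := z) ?_
  have : 2 - ‖z‖ ^ 2 = t := by rw [hz, Real.sq_sqrt (by linarith [ht.2])]; ring
  simp [radialWeight, this, hts]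

theorem hasDerivAt_integral_dilation_mul {w φ : E → ℝ} (hw : ContDiff ℝ 1 w) (hφ : Continuous φ)
    (hφs : HasCompactSupport φ) (x₀ : E) (R : ℝ) :
    HasDerivAt (fun R : ℝ => ∫ z, w (x₀ + R • z) * φ z)
      (∫ z, fderiv ℝ w (x₀ + R • z) z * φ z) R := by
  have hdw : Continuous (fderiv ℝ w) := hw.continuous_fderiv (by norm_num)
  have hwc := hw.continuous
  have hG : Continuous fun q : ℝ × E => fderiv ℝ w (x₀ + q.1 • q.2) q.2 := by fun_prop
  obtain ⟨C, hC⟩ := ((isCompact_closedBall R 1).prod hφs).exists_bound_of_continuousOn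
    hG.continuousOn
  refine (hasDerivAt_integral_of_dominated_loc_of_deriv_le (Metric.ball_mem_nhds R zero_lt_one)
    (F' := fun R z => fderiv ℝ w (x₀ + R • z) z * φ z) (bound := fun z => C * ‖φ z‖)
    ?_ ?_ ?_ ?_ ?_ ?_).2
  · exact Eventually.of_forall fun r => Continuous.aestronglyMeasurable (by fun_prop)
  · exact Continuous.integrable_of_hasCompactSupport (by fun_prop) hφs.mul_left
  · exact Continuous.aestronglyMeasurable (by fun_prop)
  · refine Eventually.of_forall fun z r hr => ?_
    rw [norm_mul]
    by_cases hz : z ∈ tsupport φ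
    · gcongr
      exact hC (r, z) ⟨Metric.ball_subset_closedBall hr, hz⟩
    · simp [image_eq_zero_of_notMem_tsupport hz]
  · exact (hφ.integrable_of_hasCompactSupport hφs).norm.const_mul C
  · refine Eventually.of_forall fun z r _ => ?_
    have h1 : HasDerivAt (fun r : ℝ => x₀ + r • z) z r := by
      simpa using ((hasDerivAt_id r).smul_const z).const_add x₀
    have h2 := (hw.differentiable (by norm_num) (x₀ + r • z)).hasFDerivAt.comp_hasDerivAt r h1
    exact h2.mul_const (φ z)

/-- The radially weighted means of a superharmonic function decrease with the radius. -/
theorem antitoneOn_integral_dilation_mul_radialWeight {w : E → ℝ} (hw : ContDiff ℝ 2 w)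
    (hΔ : ∀ x, laplacian w x ≤ 0) (x₀ : E) :
    AntitoneOn (fun R : ℝ => ∫ z, w (x₀ + R • z) * radialWeight z) (Set.Ici 0) := by
  have hw1 : ContDiff ℝ 1 w := hw.of_le (by norm_num)
  have hder := hasDerivAt_integral_dilation_mul hw1 contDiff_radialWeight.continuous
    hasCompactSupport_radialWeight x₀
  refine antitoneOn_of_deriv_nonpos (convex_Ici 0)
    (fun R _ => (hder R).continuousAt.continuousWithinAt)
    (fun R _ => (hder R).differentiableAt.differentiableWithinAt) fun R hR => ?_
  have hR : 0 < R := by simpa using hR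
  rw [(hder R).deriv]
  -- With `g z = w (x₀ + R z)`, `R` times the derivative is `-∫ ∇g · ∇Ψ = ∫ Δg Ψ`.
  have hg : ContDiff ℝ 2 fun z => w (x₀ + R • z) := by fun_prop
  have hG := integral_laplacian_mul hg (contDiff_radialPotential.of_le (by exact_mod_cast le_top))
    hasCompactSupport_radialPotential
  have hd : Differentiable ℝ w := hw.differentiable (by norm_num)
  have hdc : Continuous (fderiv ℝ w) := hw.continuous_fderiv (by norm_num)
  have key : R * ∫ z, fderiv ℝ w (x₀ + R • z) z * radialWeight z =
      ∫ z, laplacian (fun z => w (x₀ + R • z)) z * radialPotential z := by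
    rw [hG, ← integral_const_mul, ← Finset.sum_neg_distrib]
    simp_rw [← integral_neg]
    rw [← integral_finsetSum]
    · congr 1 with z
      simp_rw [fderiv_comp_add_smul hd, fderiv_radialPotential]
      conv_lhs => rw [← (stdOrthonormalBasis ℝ E).sum_repr' z, map_sum, Finset.sum_mul,
        Finset.mul_sum]
      rw [(stdOrthonormalBasis ℝ E).sum_repr' z]
      refine Finset.sum_congr rfl fun i _ => ?_
      simp only [map_smul, smul_eq_mul, _root_.smul_apply]
      rw [real_inner_comm]
      ring
    · intro i _
      have hc : Continuous fun z => fderiv ℝ (fun z => w (x₀ + R • z)) z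
          (stdOrthonormalBasis ℝ E i) * fderiv ℝ radialPotential z (stdOrthonormalBasis ℝ E i) :=
        ((contDiff_fderiv_apply (k := 1) hg _).continuous).mul
          ((contDiff_fderiv_apply (k := 0)
            (contDiff_radialPotential.of_le (by exact_mod_cast le_top)) _).continuous)
      exact (hc.integrable_of_hasCompactSupport
        (hasCompactSupport_radialPotential.fderiv_apply ℝ _).mul_left).neg
  refine nonpos_of_mul_nonpos_right (a := R) ?_ hR
  rw [key]
  refine integral_nonpos fun z => ?_
  simp only [laplacian_comp_add_smul hw]
  exact mul_nonpos_of_nonpos_of_nonneg (mul_nonpos_of_nonneg_of_nonpos (sq_nonneg R) (hΔ _))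
    (Real.smoothTransition.nonneg _)

/-- A superharmonic function whose means vanish at large scales is nonnegative, since its value
at a point dominates the means around that point. -/
theorem VanishingMeans.nonneg_of_laplacian_nonpos [Nontrivial E] {w : E → ℝ}
    (hw : ContDiff ℝ 2 w) (h : VanishingMeans w) (hΔ : ∀ x, laplacian w x ≤ 0) (x : E) :
    0 ≤ w x := by
  have hanti := antitoneOn_integral_dilation_mul_radialWeight hw hΔ x
  have hlim := h radialWeight contDiff_radialWeight hasCompactSupport_radialWeight x
  have h0 : 0 ≤ ∫ z, w (x + (0 : ℝ) • z) * radialWeight z := by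
    refine le_of_tendsto hlim ?_
    filter_upwards [eventually_ge_atTop 0] with R hR
    exact hanti Set.self_mem_Ici hR hR
  simp only [zero_smul, add_zero, integral_const_mul] at h0
  exact nonneg_of_mul_nonneg_left h0 integral_radialWeight_pos

end MeanValue

/-! ### Iterated Laplacians -/

section Iterates

variable {n : ℕ}

theorem contDiff_iterate_negLaplacian {k : ℕ} (i : ℕ) {w : EuclideanSpace ℝ (Fin n) → ℝ}
    (hw : ContDiff ℝ (k + 2 * i : ℕ) w) : ContDiff ℝ k (negLaplacian^[i] w) := by
  induction i generalizing w with
  | zero => simpa using hw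
  | succ i ih =>
    rw [Function.iterate_succ_apply]
    exact ih (contDiff_laplacian (hw.of_le (by norm_cast))).neg

theorem VanishingMeans.iterate_negLaplacian (i : ℕ) {w : EuclideanSpace ℝ (Fin n) → ℝ}
    (hw : ContDiff ℝ (2 * i : ℕ) w) (h : VanishingMeans w) :
    VanishingMeans (negLaplacian^[i] w) := by
  induction i generalizing w with
  | zero => exact h
  | succ i ih =>
    rw [Function.iterate_succ_apply]
    refine ih (contDiff_laplacian (hw.of_le (by norm_cast))).neg
      (h.neg_laplacian (hw.of_le (by norm_cast; omega)))

/-- If the means of `w` vanish at large scales and `(-Δ)^m w ≥ 0`, then all lower powers of `-Δ`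
applied to `w` are nonnegative as well. -/
theorem VanishingMeans.iterate_negLaplacian_nonneg [NeZero n] {m : ℕ}
    {w : EuclideanSpace ℝ (Fin n) → ℝ} (hw : ContDiff ℝ (2 * m : ℕ) w) (h : VanishingMeans w)
    (hm : ∀ x, 0 ≤ negLaplacian^[m] w x) {i : ℕ} (hi : i ≤ m) :
    ∀ x, 0 ≤ negLaplacian^[i] w x := by
  induction hi using Nat.decreasingInduction with
  | self => exact hm
  | of_succ i hi ih =>
    intro x
    refine VanishingMeans.nonneg_of_laplacian_nonpos
      (contDiff_iterate_negLaplacian (k := 2) i (hw.of_le (by norm_cast; omega)))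
      (h.iterate_negLaplacian i (hw.of_le (by norm_cast; omega))) (fun y => ?_) x
    have := ih y
    rw [Function.iterate_succ_apply', negLaplacian] at this
    linarith

end Iterates

/-! ### Vanishing means from a weighted integral of a power -/

section LocalCase

variable {E : Type*} [NormedAddCommGroup E] [InnerProductSpace ℝ E] [FiniteDimensional ℝ E]
  [MeasurableSpace E] [BorelSpace E]

theorem integral_comp_add_smul (f : E → ℝ) (x₀ : E) {R : ℝ} (hR : 0 < R) :
    ∫ z, f (x₀ + R • z) = (R ^ finrank ℝ E)⁻¹ * ∫ x, f x := by
  rw [Measure.integral_comp_smul volume (fun z => f (x₀ + z)) R, integral_add_left_eq_self f x₀,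
    abs_of_nonneg (by positivity), smul_eq_mul]

/-- If `f / |x - x₀|^σ` is integrable with `σ < d`, then the means of `f` over large balls
around `x₀` tend to zero. -/
theorem tendsto_setIntegral_closedBall_dilation [Nontrivial E] {f : E → ℝ} {σ ρ : ℝ} {x₀ : E}
    (hf : Continuous f) (hf0 : ∀ x, 0 ≤ f x) (hσ : σ < finrank ℝ E) (hρ : 0 < ρ)
    (hint : Integrable fun y => 1 / ‖x₀ - y‖ ^ σ * f y) :
    Tendsto (fun R : ℝ => ∫ z in Metric.closedBall 0 ρ, f (x₀ + R • z)) atTop (𝓝 0) := by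
  have hrew : ∀ R : ℝ, 0 < R → ∫ z in Metric.closedBall 0 ρ, f (x₀ + R • z) =
      ∫ x, (R ^ finrank ℝ E)⁻¹ * (Metric.closedBall x₀ (R * ρ)).indicator f x := by
    intro R hR
    rw [integral_const_mul, ← integral_comp_add_smul _ x₀ hR,
      ← integral_indicator measurableSet_closedBall]
    congr 1 with z
    have : z ∈ Metric.closedBall 0 ρ ↔ x₀ + R • z ∈ Metric.closedBall x₀ (R * ρ) := by
      simp [norm_smul, abs_of_pos hR, hR]
    by_cases hz : z ∈ Metric.closedBall 0 ρ
    · rw [Set.indicator_of_mem hz, Set.indicator_of_mem (this.1 hz)]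
    · rw [Set.indicator_of_notMem hz, Set.indicator_of_notMem (mt this.2 hz)]
  have hd : finrank ℝ E ≠ 0 := finrank_pos.ne'
  suffices Tendsto (fun R : ℝ => ∫ x, (R ^ finrank ℝ E)⁻¹ *
      (Metric.closedBall x₀ (R * ρ)).indicator f x) atTop (𝓝 (∫ _ : E, (0 : ℝ))) by
    rw [integral_zero] at this
    refine this.congr' ?_
    filter_upwards [eventually_gt_atTop 0] with R hR using (hrew R hR).symm
  refine tendsto_integral_filter_of_dominated_convergence
    (fun x => (Metric.closedBall x₀ 1).indicator f x +
      (1 + ρ ^ σ) * (1 / ‖x₀ - x‖ ^ σ * f x)) ?_ ?_ ?_ ?_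
  · refine Eventually.of_forall fun R => ?_
    exact (hf.aestronglyMeasurable.indicator measurableSet_closedBall).const_mul _
  · filter_upwards [eventually_ge_atTop 1] with R hR
    refine Eventually.of_forall fun x => ?_
    have hRd : 1 ≤ R ^ finrank ℝ E := one_le_pow₀ hR
    have hi1 : 0 ≤ (Metric.closedBall x₀ 1).indicator f x :=
      Set.indicator_nonneg (fun y _ => hf0 y) x
    have hi2 : 0 ≤ (Metric.closedBall x₀ (R * ρ)).indicator f x :=
      Set.indicator_nonneg (fun y _ => hf0 y) x
    have hh : 0 ≤ 1 / ‖x₀ - x‖ ^ σ * f x := mul_nonneg (by positivity) (hf0 x)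
    have hρσ : 0 ≤ ρ ^ σ := by positivity
    rw [Real.norm_of_nonneg (by positivity)]
    by_cases hx : x ∈ Metric.closedBall x₀ (R * ρ)
    · rw [Set.indicator_of_mem hx]
      by_cases hx1 : x ∈ Metric.closedBall x₀ 1
      · rw [Set.indicator_of_mem hx1]
        have : (R ^ finrank ℝ E)⁻¹ * f x ≤ 1 * f x :=
          mul_le_mul_of_nonneg_right (inv_le_one_of_one_le₀ hRd) (hf0 x)
        nlinarith [mul_nonneg (add_nonneg zero_le_one hρσ) hh]
      · rw [Set.indicator_of_notMem hx1, zero_add]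
        have hx1 : 1 < ‖x₀ - x‖ := by simpa [dist_eq_norm, norm_sub_rev] using hx1
        have hx : ‖x₀ - x‖ ≤ R * ρ := by simpa [dist_eq_norm, norm_sub_rev] using hx
        rw [← mul_assoc]
        refine mul_le_mul_of_nonneg_right ?_ (hf0 x)
        have hpos : 0 < ‖x₀ - x‖ ^ σ := by positivity
        rw [mul_one_div, le_div_iff₀ hpos, inv_mul_le_iff₀ (by positivity)]
        -- `|x - x₀|^σ ≤ R^d (1 + ρ^σ)` for `1 ≤ |x - x₀| ≤ R ρ`, whatever the sign of `σ`.
        rcases le_total 0 σ with h | h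
        · calc ‖x₀ - x‖ ^ σ ≤ (R * ρ) ^ σ := by gcongr
            _ = R ^ σ * ρ ^ σ := Real.mul_rpow (by positivity) hρ.le
            _ ≤ R ^ (finrank ℝ E : ℝ) * (1 + ρ ^ σ) := by
              gcongr
              · linarith
            _ = _ := by rw [Real.rpow_natCast]
        · calc ‖x₀ - x‖ ^ σ ≤ 1 := Real.rpow_le_one_of_one_le_of_nonpos hx1.le h
            _ ≤ R ^ finrank ℝ E * (1 + ρ ^ σ) := by nlinarith
    · rw [Set.indicator_of_notMem hx, mul_zero]
      positivity
  · exact ((hf.continuousOn.integrableOn_compact (isCompact_closedBall _ _)).integrable_indicator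
      measurableSet_closedBall).add (hint.const_mul _)
  · refine Eventually.of_forall fun x => ?_
    have h1 : Tendsto (fun R : ℝ => (R ^ finrank ℝ E)⁻¹ * f x) atTop (𝓝 0) := by
      simpa using ((tendsto_pow_atTop (α := ℝ) hd).inv_tendsto_atTop).mul_const (f x)
    refine squeeze_zero' ?_ ?_ h1
    · filter_upwards [eventually_ge_atTop 0] with R hR
      exact mul_nonneg (by positivity) (Set.indicator_nonneg (fun y _ => hf0 y) x)
    · filter_upwards [eventually_ge_atTop 0] with R hR
      gcongr
      exact Set.indicator_le_self' (fun _ _ => hf0 _) x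

/-- The convergence of `∫ |u y|^p |x - y|^(-σ) dy` with `p ≥ 1` and `σ < d` forces the means of
`u` to vanish at large scales. -/
theorem vanishingMeans_of_integrable_rpow [Nontrivial E] {u : E → ℝ} {σ p : ℝ}
    (hu : Continuous u) (hσ : σ < finrank ℝ E) (hp : 1 ≤ p)
    (hint : ∀ x, Integrable fun y => 1 / ‖x - y‖ ^ σ * |u y| ^ p) : VanishingMeans u := by
  intro φ hφ hφs x₀
  obtain ⟨ρ, hρ, hsupp⟩ : ∃ ρ, 0 < ρ ∧ tsupport φ ⊆ Metric.closedBall 0 ρ := by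
    obtain ⟨r, hr⟩ := (Metric.isBounded_iff_subset_closedBall (0 : E)).1 hφs.isBounded
    exact ⟨max r 1, by positivity, hr.trans (Metric.closedBall_subset_closedBall (le_max_left _ _))⟩
  obtain ⟨C, hC⟩ := hφs.exists_bound_of_continuous hφ.continuous
  have hC0 : 0 ≤ C := (norm_nonneg _).trans (hC 0)
  have hf : Continuous fun x => |u x| ^ p :=
    hu.abs.rpow_const fun _ => Or.inr (by linarith)
  have hmean := tendsto_setIntegral_closedBall_dilation hf (fun _ => by positivity) hσ hρ (hint x₀)
  set I := ∫ z, |φ z|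
  have hI : 0 ≤ I := integral_nonneg fun _ => abs_nonneg _
  -- `t ≤ δ + δ^(1-p) t^p` splits the mean of `u` into a small part and a mean of `u^p`.
  have hbound : ∀ δ : ℝ, 0 < δ → ∀ R : ℝ, |∫ z, u (x₀ + R • z) * φ z| ≤
      δ * I + δ ^ (1 - p) * C * ∫ z in Metric.closedBall 0 ρ, |u (x₀ + R • z)| ^ p := by
    intro δ hδ R
    have hcont : Continuous fun z : E => |u (x₀ + R • z)| ^ p := hf.comp (by fun_prop)
    have hi1 : Integrable fun z => δ * |φ z| :=
      (hφ.continuous.integrable_of_hasCompactSupport hφs).abs.const_mul δ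
    have hi2 : Integrable fun z => δ ^ (1 - p) * C *
        (Metric.closedBall 0 ρ).indicator (fun z => |u (x₀ + R • z)| ^ p) z :=
      ((hcont.continuousOn.integrableOn_compact (isCompact_closedBall _ _)).integrable_indicator
        measurableSet_closedBall).const_mul _
    rw [← integral_indicator measurableSet_closedBall, ← integral_const_mul, ← integral_const_mul,
      ← integral_add hi1 hi2, ← Real.norm_eq_abs]
    refine norm_integral_le_of_norm_le (hi1.add hi2) (Eventually.of_forall fun z => ?_)
    simp only [norm_mul, Real.norm_eq_abs]
    by_cases hz : z ∈ tsupport φ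
    · rw [Set.indicator_of_mem (hsupp hz)]
      have hcz : |φ z| ≤ C := hC z
      set t := |u (x₀ + R • z)|
      have ht : 0 ≤ t := abs_nonneg _
      rcases le_total t δ with h | h
      · have : t * |φ z| ≤ δ * |φ z| := by gcongr
        have : 0 ≤ δ ^ (1 - p) * C * t ^ p := by positivity
        linarith
      · have ht0 : 0 < t := hδ.trans_le h
        have h1 : t ≤ δ ^ (1 - p) * t ^ p := by
          calc t = t ^ (1 - p) * t ^ p := by rw [← Real.rpow_add ht0]; simp
            _ ≤ δ ^ (1 - p) * t ^ p := by
              gcongr ?_ * _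
              exact Real.rpow_le_rpow_of_nonpos hδ h (by linarith)
        calc t * |φ z| ≤ (δ ^ (1 - p) * t ^ p) * C := by gcongr
          _ ≤ _ := by nlinarith [mul_nonneg hδ.le (abs_nonneg (φ z))]
    · rw [image_eq_zero_of_notMem_tsupport hz]
      simp only [abs_zero, mul_zero, zero_add]
      exact mul_nonneg (by positivity) (Set.indicator_nonneg (fun _ _ => by positivity) _)
  rw [Metric.tendsto_atTop']
  intro ε hε
  obtain ⟨δ, hδ, hδI⟩ : ∃ δ : ℝ, 0 < δ ∧ δ * I < ε / 2 := by
    refine ⟨ε / 2 / (I + 1), by positivity, ?_⟩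
    rw [div_mul_eq_mul_div, div_lt_iff₀ (by positivity)]
    nlinarith
  have hlim : Tendsto (fun R : ℝ => δ ^ (1 - p) * C *
      ∫ z in Metric.closedBall 0 ρ, |u (x₀ + R • z)| ^ p) atTop (𝓝 0) := by
    simpa using hmean.const_mul (δ ^ (1 - p) * C)
  obtain ⟨N, hN⟩ := eventually_atTop.1 (hlim.eventually_lt_const (half_pos hε))
  refine ⟨N, fun R hR => ?_⟩
  rw [Real.dist_eq, sub_zero]
  linarith [hbound δ hδ R, hN R hR.le]

end LocalCase

/-! ### Polynomial weights -/

section Weight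

variable {E : Type} [NormedAddCommGroup E]

theorem norm_le_of_mem_ball_one {x x₀ : E} (hx : x ∈ Metric.ball x₀ 1) : ‖x‖ ≤ ‖x₀‖ + 1 := by
  have h1 : ‖x - x₀‖ < 1 := by simpa [dist_eq_norm] using hx
  linarith [norm_sub_norm_le x x₀]

/-- Peetre-type inequality: translations by bounded vectors change the weight `1 + ‖y‖^β` by at
most a constant factor. -/
theorem exists_weight_le {β : ℝ} (hβ : 0 ≤ β) (ρ : ℝ) :
    ∃ A : ℝ, 0 < A ∧ ∀ x y : E, ‖x‖ ≤ ρ → 1 + ‖y‖ ^ β ≤ A * (1 + ‖y - x‖ ^ β) := by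
  refine ⟨1 + 2 ^ β * (1 + |ρ| ^ β), by positivity, fun x y hx => ?_⟩
  have hx : ‖x‖ ≤ |ρ| := hx.trans (le_abs_self ρ)
  have hy : ‖y‖ ≤ 2 * max ‖y - x‖ |ρ| := by
    have : ‖y‖ ≤ ‖y - x‖ + ‖x‖ := by simpa using norm_add_le (y - x) x
    linarith [le_max_left ‖y - x‖ |ρ|, le_max_right ‖y - x‖ |ρ|]
  have h1 : ‖y‖ ^ β ≤ 2 ^ β * (‖y - x‖ ^ β + |ρ| ^ β) := by
    calc ‖y‖ ^ β ≤ (2 * max ‖y - x‖ |ρ|) ^ β := by gcongr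
      _ = 2 ^ β * (max ‖y - x‖ |ρ|) ^ β := Real.mul_rpow zero_le_two (by positivity)
      _ ≤ _ := by
        gcongr
        have h1 : 0 ≤ ‖y - x‖ ^ β := by positivity
        have h2 : 0 ≤ |ρ| ^ β := by positivity
        rcases max_choice ‖y - x‖ |ρ| with h | h <;> rw [h] <;> linarith
  have h2 : (0 : ℝ) ≤ 2 ^ β := by positivity
  have h3 : 0 ≤ ‖y - x‖ ^ β := by positivity
  have h4 : 0 ≤ |ρ| ^ β := by positivity
  nlinarith [mul_nonneg (mul_nonneg h2 h3) h4, mul_nonneg h2 h3, mul_nonneg h2 h4]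

theorem exists_inv_weight_le {β : ℝ} (hβ : 0 ≤ β) (ρ : ℝ) :
    ∃ A : ℝ, 0 < A ∧ ∀ x y : E, ‖x‖ ≤ ρ → (1 + ‖y - x‖ ^ β)⁻¹ ≤ A * (1 + ‖y‖ ^ β)⁻¹ := by
  obtain ⟨A, hA, hw⟩ := exists_weight_le (E := E) hβ ρ
  refine ⟨A, hA, fun x y hx => ?_⟩
  rw [← div_eq_mul_inv, inv_eq_one_div, div_le_div_iff₀ (by positivity) (by positivity), one_mul]
  exact hw x y hx

theorem integrable_inv_weight [NormedSpace ℝ E] [FiniteDimensional ℝ E] [MeasurableSpace E]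
    [BorelSpace E] {μ : Measure E} [μ.IsAddHaarMeasure] {β : ℝ} (hβ : (finrank ℝ E : ℝ) < β) :
    Integrable (fun y : E => (1 + ‖y‖ ^ β)⁻¹) μ := by
  have hβ0 : 0 < β := (Nat.cast_nonneg _).trans_lt hβ
  refine ((integrable_one_add_norm (μ := μ) hβ).const_mul (2 ^ β)).mono'
    (Measurable.aestronglyMeasurable (by fun_prop)) (Eventually.of_forall fun y => ?_)
  rw [Real.norm_of_nonneg (by positivity), Real.rpow_neg (by positivity), ← div_eq_mul_inv,
    inv_eq_one_div, div_le_div_iff₀ (by positivity) (by positivity), one_mul]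
  have h0 : 0 ≤ ‖y‖ ^ β := by positivity
  have h2 : (1 : ℝ) ≤ 2 ^ β := Real.one_le_rpow one_le_two hβ0.le
  rcases le_total ‖y‖ 1 with h | h
  · calc (1 + ‖y‖) ^ β ≤ 2 ^ β := by gcongr; linarith
      _ ≤ 2 ^ β * (1 + ‖y‖ ^ β) := by nlinarith
  · calc (1 + ‖y‖) ^ β ≤ (2 * ‖y‖) ^ β := by gcongr; linarith
      _ = 2 ^ β * ‖y‖ ^ β := Real.mul_rpow zero_le_two (norm_nonneg y)
      _ ≤ 2 ^ β * (1 + ‖y‖ ^ β) := by nlinarith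

end Weight

/-! ### Splitting of the singular kernel and the far field -/

section Kernels

variable {E : Type} [NormedAddCommGroup E] [InnerProductSpace ℝ E]

variable (E) in
/-- A smooth even cutoff function, equal to `1` on the unit ball and to `0` outside the ball of
radius `2`. -/
def unitCutoff : ContDiffBump (0 : E) := ⟨1, 2, zero_lt_one, one_lt_two⟩

/-- The part of the kernel `‖z‖^(-β)` near its singularity. -/
def nearKernel (β : ℝ) (z : E) : ℝ := unitCutoff E z * ‖z‖ ^ (-β)

/-- The part of the kernel `‖z‖^(-β)` away from its singularity, a smooth function. -/
def farKernel (β : ℝ) (z : E) : ℝ := (1 - unitCutoff E z) * ‖z‖ ^ (-β)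

theorem nearKernel_add_farKernel (β : ℝ) (z : E) :
    nearKernel β z + farKernel β z = ‖z‖ ^ (-β) := by
  simp only [nearKernel, farKernel]; ring

theorem nearKernel_nonneg (β : ℝ) (z : E) : 0 ≤ nearKernel β z :=
  mul_nonneg (unitCutoff E).nonneg (by positivity)

theorem farKernel_nonneg (β : ℝ) (z : E) : 0 ≤ farKernel β z :=
  mul_nonneg (sub_nonneg.2 (unitCutoff E).le_one) (by positivity)

theorem nearKernel_eq_zero (β : ℝ) {z : E} (hz : 2 ≤ ‖z‖) : nearKernel β z = 0 := by
  rw [nearKernel, (unitCutoff E).zero_of_le_dist (by simpa [unitCutoff] using hz), zero_mul]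

theorem farKernel_eq_of_two_le (β : ℝ) {z : E} (hz : 2 ≤ ‖z‖) : farKernel β z = ‖z‖ ^ (-β) := by
  rw [← nearKernel_add_farKernel, nearKernel_eq_zero β hz, zero_add]

theorem farKernel_neg (β : ℝ) (z : E) : farKernel β (-z) = farKernel β z := by
  rw [farKernel, farKernel, (unitCutoff E).neg, norm_neg]

theorem contDiff_farKernel (β : ℝ) : ContDiff ℝ ∞ (farKernel β : E → ℝ) := by
  rw [contDiff_iff_contDiffAt]
  intro z
  by_cases hz : z = 0
  · subst hz
    refine (contDiffAt_const (c := (0 : ℝ))).congr_of_eventuallyEq ?_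
    filter_upwards [Metric.closedBall_mem_nhds (0 : E) zero_lt_one] with y hy
    rw [farKernel, (unitCutoff E).one_of_mem_closedBall hy, sub_self, zero_mul]
  · exact (contDiffAt_const.sub (unitCutoff E).contDiff.contDiffAt).mul
      ((contDiffAt_norm ℝ hz).rpow_const_of_ne (norm_ne_zero_iff.2 hz))

/-- Smooth functions that are positively homogeneous of some degree `-s ≤ -β` at infinity. This
class is stable under differentiation and consists of functions of size `O((1 + ‖z‖^β)⁻¹)`. -/
def AsympHomogeneous {F : Type} [NormedAddCommGroup F] [NormedSpace ℝ F] (β : ℝ)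
    (k : E → F) : Prop :=
  ContDiff ℝ ∞ k ∧ ∃ s, β ≤ s ∧ ∀ z : E, 2 < ‖z‖ → ∀ l : ℝ, 1 ≤ l → k (l • z) = l ^ (-s) • k z

theorem asympHomogeneous_farKernel (β : ℝ) : AsympHomogeneous β (farKernel β : E → ℝ) := by
  refine ⟨contDiff_farKernel β, β, le_rfl, fun z hz l hl => ?_⟩
  have hlz : ‖l • z‖ = l * ‖z‖ := by rw [norm_smul, Real.norm_of_nonneg (by linarith)]
  rw [farKernel_eq_of_two_le β hz.le, farKernel_eq_of_two_le β (by rw [hlz]; nlinarith), hlz,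
    Real.mul_rpow (by linarith) (norm_nonneg z), smul_eq_mul]

variable {F : Type} [NormedAddCommGroup F] [NormedSpace ℝ F]

theorem AsympHomogeneous.fderiv {β : ℝ} {k : E → F} (hk : AsympHomogeneous β k) :
    AsympHomogeneous β (fderiv ℝ k) := by
  obtain ⟨hsm, s, hs, h⟩ := hk
  refine ⟨(contDiff_infty_iff_fderiv.1 hsm).2, s + 1, by linarith, fun z hz l hl => ?_⟩
  have hl0 : 0 < l := by linarith
  have hd : Differentiable ℝ k := hsm.differentiable (by simp)
  have h1 := fderiv_comp_add_smul hd 0 l z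
  have h2 : (fun z => k (0 + l • z)) =ᶠ[𝓝 z] fun z => l ^ (-s) • k z := by
    filter_upwards [(isOpen_lt continuous_const continuous_norm).mem_nhds hz] with y hy
    rw [zero_add, h y hy l hl]
  rw [h2.fderiv_eq, fderiv_fun_const_smul (hd z), zero_add] at h1
  rw [neg_add, Real.rpow_add hl0, Real.rpow_neg_one, mul_comm, mul_smul, h1,
    inv_smul_smul₀ hl0.ne']

variable [FiniteDimensional ℝ E]

theorem AsympHomogeneous.exists_norm_le {β : ℝ} (hβ : 0 ≤ β) {k : E → F}
    (hk : AsympHomogeneous β k) : ∃ C, 0 ≤ C ∧ ∀ z, ‖k z‖ ≤ C * (1 + ‖z‖ ^ β)⁻¹ := by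
  obtain ⟨hsm, s, hs, h⟩ := hk
  obtain ⟨M, hM⟩ := (isCompact_closedBall (0 : E) 3).exists_bound_of_continuousOn
    hsm.continuous.continuousOn
  have hM0 : 0 ≤ M := (norm_nonneg _).trans (hM 0 (by simp))
  have h3 : (0 : ℝ) ≤ 3 ^ β := by positivity
  refine ⟨2 * M * (1 + 3 ^ β), by positivity, fun z => ?_⟩
  rw [← div_eq_mul_inv, le_div_iff₀ (by positivity)]
  have hz0 : 0 ≤ ‖z‖ ^ β := by positivity
  rcases le_or_gt ‖z‖ 3 with hz | hz
  · have h1 : ‖z‖ ^ β ≤ 3 ^ β := by gcongr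
    calc ‖k z‖ * (1 + ‖z‖ ^ β) ≤ M * (1 + 3 ^ β) := by
          gcongr
          exact hM z (by simpa using hz)
      _ ≤ _ := by nlinarith
  · set l := ‖z‖ / 3 with hl
    have hl1 : 1 ≤ l := by rw [hl]; linarith
    have hl0 : 0 < l := by linarith
    set y := l⁻¹ • z with hy
    have hyn : ‖y‖ = 3 := by
      rw [hy, norm_smul, Real.norm_of_nonneg (by positivity), hl]
      field_simp
    have hzy : z = l • y := by rw [hy, smul_inv_smul₀ hl0.ne']
    have hk1 : ‖k z‖ ≤ l ^ (-β) * M := by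
      rw [hzy, h y (by rw [hyn]; norm_num) l hl1, norm_smul, Real.norm_of_nonneg (by positivity)]
      gcongr
      exact hM y (by simp [hyn])
    have hlz : ‖z‖ ^ β = 3 ^ β * l ^ β := by
      rw [← Real.mul_rpow (by norm_num) hl0.le, hl]
      congr 1
      ring
    have hl2 : l ^ (-β) * l ^ β = 1 := by rw [← Real.rpow_add hl0]; simp
    have hl3 : 1 ≤ l ^ β := Real.one_le_rpow hl1 hβ
    calc ‖k z‖ * (1 + ‖z‖ ^ β) ≤ l ^ (-β) * M * (l ^ β + 3 ^ β * l ^ β) := by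
          rw [hlz]
          gcongr
      _ = M * (1 + 3 ^ β) := by linear_combination (M + M * 3 ^ β) * hl2
      _ ≤ _ := by nlinarith

variable [MeasurableSpace E] [BorelSpace E]

/-- Far-field integrals are differentiated under the integral sign; the derivative falls on the
kernel, so that `w` needs no regularity. -/
theorem hasFDerivAt_integral_smul_farField {β : ℝ} (hβ : 0 ≤ β) {w : E → ℝ}
    (hw : Integrable fun y => |w y| / (1 + ‖y‖ ^ β)) (hwm : AEStronglyMeasurable w)
    {k : E → F} (hk : AsympHomogeneous β k) (x₀ : E) :
    HasFDerivAt (fun x => ∫ y, w y • k (x - y)) (∫ y, w y • fderiv ℝ k (x₀ - y)) x₀ := by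
  have hkc : Continuous k := hk.1.continuous
  have hk'c : Continuous (fderiv ℝ k) := hk.fderiv.1.continuous
  -- One bound serves for `k` and for its derivative, uniformly for `x` near `x₀`.
  have hbound : ∀ {G : Type} [NormedAddCommGroup G] [NormedSpace ℝ G] {k : E → G},
      AsympHomogeneous β k → ∃ C, ∀ x ∈ Metric.ball x₀ 1, ∀ y,
        ‖w y • k (x - y)‖ ≤ C * (|w y| / (1 + ‖y‖ ^ β)) := by
    intro G _ _ k hk
    obtain ⟨C, hC0, hC⟩ := hk.exists_norm_le hβ
    obtain ⟨A, hA, hw⟩ := exists_inv_weight_le (E := E) hβ (‖x₀‖ + 1)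
    refine ⟨C * A, fun x hx y => ?_⟩
    have h3 := hw x y (norm_le_of_mem_ball_one hx)
    rw [norm_sub_rev] at h3
    rw [norm_smul, Real.norm_eq_abs]
    calc |w y| * ‖k (x - y)‖ ≤ |w y| * (C * (A * (1 + ‖y‖ ^ β)⁻¹)) := by
          gcongr
          exact (hC _).trans (by gcongr)
      _ = _ := by ring
  obtain ⟨C, hC⟩ := hbound hk
  obtain ⟨C', hC'⟩ := hbound hk.fderiv
  refine hasFDerivAt_integral_of_dominated_of_fderiv_le (𝕜 := ℝ)
    (F' := fun x y => w y • fderiv ℝ k (x - y)) (Metric.ball_mem_nhds x₀ zero_lt_one)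
    (bound := fun y => C' * (|w y| / (1 + ‖y‖ ^ β))) ?_ ?_ ?_ ?_ ?_ ?_
  · exact Eventually.of_forall fun x => hwm.smul (by fun_prop)
  · exact (hw.const_mul C).mono' (hwm.smul (by fun_prop))
      (Eventually.of_forall (hC x₀ (Metric.mem_ball_self zero_lt_one)))
  · exact hwm.smul (by fun_prop)
  · exact Eventually.of_forall fun y x hx => hC' x hx y
  · exact hw.const_mul C'
  · refine Eventually.of_forall fun y x _ => ?_
    have h1 : HasFDerivAt (fun x : E => x - y) (ContinuousLinearMap.id ℝ E) x :=
      (hasFDerivAt_id x).sub_const y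
    have h2 := (hk.1.differentiable (by simp) (x - y)).hasFDerivAt.comp x h1
    exact h2.const_smul (w y)

theorem contDiff_integral_smul_farField {β : ℝ} (hβ : 0 ≤ β) {w : E → ℝ}
    (hw : Integrable fun y => |w y| / (1 + ‖y‖ ^ β)) (hwm : AEStronglyMeasurable w) (N : ℕ)
    {F : Type} [NormedAddCommGroup F] [NormedSpace ℝ F]
    {k : E → F} (hk : AsympHomogeneous β k) : ContDiff ℝ N fun x => ∫ y, w y • k (x - y) := by
  have hd : ∀ {G : Type} [NormedAddCommGroup G] [NormedSpace ℝ G] {k : E → G},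
      AsympHomogeneous β k → Differentiable ℝ fun x => ∫ y, w y • k (x - y) :=
    fun hk x => (hasFDerivAt_integral_smul_farField hβ hw hwm hk x).differentiableAt
  induction N generalizing F with
  | zero => exact contDiff_zero.2 (hd hk).continuous
  | succ N ih =>
    rw [Nat.cast_succ, contDiff_succ_iff_fderiv]
    refine ⟨hd hk, by simp, ?_⟩
    rw [show fderiv ℝ (fun x => ∫ y, w y • k (x - y)) = fun x => ∫ y, w y • fderiv ℝ k (x - y) from
      funext fun x => (hasFDerivAt_integral_smul_farField hβ hw hwm hk x).fderiv]
    exact ih hk.fderiv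

theorem measurable_nearKernel (β : ℝ) : Measurable (nearKernel β : E → ℝ) :=
  (unitCutoff E).continuous.measurable.mul (by fun_prop)

theorem integrable_farKernel {β : ℝ} (hβ : (finrank ℝ E : ℝ) < β) :
    Integrable (farKernel β : E → ℝ) := by
  have hβ0 : 0 ≤ β := (Nat.cast_nonneg _).trans hβ.le
  obtain ⟨C, -, hC⟩ := (asympHomogeneous_farKernel (E := E) β).exists_norm_le hβ0
  exact ((integrable_inv_weight hβ).const_mul C).mono'
    (contDiff_farKernel β).continuous.aestronglyMeasurable (Eventually.of_forall hC)

/-- Near the origin, the kernel `‖z‖^(-β)` is integrable against `‖z‖^s` for `s > β - d`. -/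
theorem integrable_nearKernel_mul_rpow [Nontrivial E] {β s : ℝ} (hs : β < finrank ℝ E + s) :
    Integrable fun z : E => nearKernel β z * ‖z‖ ^ s := by
  have h1 : IntegrableOn (fun z : E => ‖z‖ ^ (-β) * ‖z‖ ^ s) (Metric.ball 0 2) := by
    rw [integrableOn_fun_norm_addHaar volume (f := fun r => r ^ (-β) * r ^ s)]
    refine ((intervalIntegral.integrableOn_Ioo_rpow_iff (s := (finrank ℝ E : ℝ) - 1 + s - β)
      two_pos).2 (by linarith)).congr_fun (fun r hr => ?_) measurableSet_Ioo
    have hr0 : 0 < r := hr.1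
    have h1 : (1 : ℕ) ≤ finrank ℝ E := finrank_pos
    simp only [smul_eq_mul]
    rw [← Real.rpow_natCast, ← Real.rpow_add hr0, ← Real.rpow_add hr0, Nat.cast_sub h1]
    congr 1
    push_cast
    ring
  refine (h1.integrable_indicator measurableSet_ball).mono'
    ((measurable_nearKernel β).mul (by fun_prop)).aestronglyMeasurable
    (Eventually.of_forall fun z => ?_)
  rw [Real.norm_of_nonneg (mul_nonneg (nearKernel_nonneg β z) (by positivity))]
  by_cases hz : z ∈ Metric.ball (0 : E) 2
  · rw [Set.indicator_of_mem hz]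
    gcongr
    exact mul_le_of_le_one_left (by positivity) (unitCutoff E).le_one
  · rw [Set.indicator_of_notMem hz, nearKernel_eq_zero β (by simpa using hz), zero_mul]

end Kernels

/-! ### Second differences of Hölder functions -/

section SecondDifferences

variable {E : Type} [NormedAddCommGroup E] {F : Type} [NormedAddCommGroup F]

/-- The symmetric second difference `2 V x - V (x + z) - V (x - z)`. -/
def secondDiff (V : E → F) (x z : E) : F := (V x - V (x + z)) + (V x - V (x - z))

/-- Second differences of `V` of step `z`, `‖z‖ ≤ 2`, are `O(‖z‖^s)` locally uniformly. -/
def SecondDiffBound (s : ℝ) (V : E → F) : Prop :=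
  ∀ ρ : ℝ, ∃ C, 0 ≤ C ∧ ∀ x z : E, ‖x‖ ≤ ρ → ‖z‖ ≤ 2 → ‖secondDiff V x z‖ ≤ C * ‖z‖ ^ s

/-- Hölder continuity with exponent `γ` on every ball centred at the origin. -/
def BallHolder (γ : ℝ) (g : E → F) : Prop :=
  ∀ ρ : ℝ, ∃ C, 0 ≤ C ∧ ∀ x y : E, ‖x‖ ≤ ρ → ‖y‖ ≤ ρ → ‖g x - g y‖ ≤ C * ‖x - y‖ ^ γ

theorem BallHolder.secondDiffBound {γ : ℝ} {V : E → F} (h : BallHolder γ V) :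
    SecondDiffBound γ V := by
  intro ρ
  obtain ⟨C, hC0, hC⟩ := h (ρ + 2)
  refine ⟨2 * C, by positivity, fun x z hx hz => ?_⟩
  have h1 := hC x (x + z) (by linarith) ((norm_add_le x z).trans (by linarith))
  have h2 := hC x (x - z) (by linarith) ((norm_sub_le x z).trans (by linarith))
  simp only [sub_add_cancel_left, norm_neg, sub_sub_cancel] at h1 h2
  exact (norm_add_le _ _).trans (by linarith)

theorem continuous_secondDiff_right {V : E → F} (hV : Continuous V) (x : E) :
    Continuous fun z => secondDiff V x z := by
  unfold secondDiff; fun_prop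

variable [NormedSpace ℝ E] [NormedSpace ℝ F]

theorem BallHolder.secondDiffBound_one_add {γ : ℝ} (hγ : 0 ≤ γ) {V : E → F}
    (hV : Differentiable ℝ V) (h : BallHolder γ (fderiv ℝ V)) : SecondDiffBound (1 + γ) V := by
  intro ρ
  obtain ⟨C, hC0, hC⟩ := h (ρ + 2)
  refine ⟨C * 2 ^ γ, by positivity, fun x z hx hz => ?_⟩
  have hd : ∀ t : ℝ, HasDerivAt (fun t : ℝ => secondDiff V x (t • z))
      (-(fderiv ℝ V (x + t • z) z) + fderiv ℝ V (x - t • z) z) t := by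
    intro t
    have h1 : HasDerivAt (fun t : ℝ => t • z) z t := by simpa using (hasDerivAt_id t).smul_const z
    have h2 := ((hV (x + t • z)).hasFDerivAt.comp_hasDerivAt t (h1.const_add x)).const_sub (V x)
    have h3 := ((hV (x - t • z)).hasFDerivAt.comp_hasDerivAt t (h1.const_sub x)).const_sub (V x)
    exact (h2.add h3).congr_deriv (by simp)
  have hle := norm_image_sub_le_of_norm_deriv_le_segment_01'
    (f := fun t : ℝ => secondDiff V x (t • z)) (C := C * 2 ^ γ * ‖z‖ ^ (1 + γ))
    (fun t _ => (hd t).hasDerivWithinAt) fun t ht => ?_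
  · simpa [secondDiff] using hle
  have htz : ‖t • z‖ ≤ ‖z‖ := by
    rw [norm_smul, Real.norm_of_nonneg ht.1]
    exact mul_le_of_le_one_left (norm_nonneg z) ht.2.le
  have h1 := hC (x - t • z) (x + t • z) ((norm_sub_le _ _).trans (by linarith))
    ((norm_add_le _ _).trans (by linarith))
  have h2 : ‖x - t • z - (x + t • z)‖ ≤ 2 * ‖z‖ := by
    rw [show x - t • z - (x + t • z) = -(t • z + t • z) by abel, norm_neg]
    exact (norm_add_le _ _).trans (by linarith)
  rw [neg_add_eq_sub, ← _root_.sub_apply]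
  calc _ ≤ ‖fderiv ℝ V (x - t • z) - fderiv ℝ V (x + t • z)‖ * ‖z‖ :=
        ContinuousLinearMap.le_opNorm _ _
    _ ≤ C * (2 * ‖z‖) ^ γ * ‖z‖ := by
        gcongr
        exact h1.trans (by gcongr)
    _ = C * 2 ^ γ * ‖z‖ ^ (1 + γ) := by
        rw [Real.mul_rpow zero_le_two (norm_nonneg z),
          Real.rpow_add' (norm_nonneg z) (by positivity), Real.rpow_one]
        ring

theorem ballHolder_of_contDiff [FiniteDimensional ℝ E] {γ : ℝ} (hγ1 : γ ≤ 1)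
    {g : E → F} (hg : ContDiff ℝ 1 g) : BallHolder γ g := by
  intro ρ
  obtain ⟨M, hM⟩ := (isCompact_closedBall (0 : E) ρ).exists_bound_of_continuousOn
    (hg.continuous_fderiv (by norm_num)).continuousOn
  refine ⟨|M| * (2 * |ρ|) ^ (1 - γ), by positivity, fun x y hx hy => ?_⟩
  have h1 := (convex_closedBall (0 : E) ρ).norm_image_sub_le_of_norm_fderiv_le
    (fun z _ => hg.differentiable (by norm_num) z) hM (x := y) (y := x)
    (by simpa using hy) (by simpa using hx)
  have h2 : ‖x - y‖ ≤ 2 * |ρ| := by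
    linarith [norm_sub_le x y, le_abs_self ρ]
  have h3 : ‖x - y‖ = ‖x - y‖ ^ (1 - γ) * ‖x - y‖ ^ γ := by
    rw [← Real.rpow_add' (norm_nonneg _) (by simp)]; simp
  calc ‖g x - g y‖ ≤ |M| * ‖x - y‖ := h1.trans (by gcongr; exact le_abs_self M)
    _ = |M| * (‖x - y‖ ^ (1 - γ) * ‖x - y‖ ^ γ) := by rw [← h3]
    _ ≤ |M| * ((2 * |ρ|) ^ (1 - γ) * ‖x - y‖ ^ γ) := by
        gcongr
    _ = _ := by ring

/-- The class `C^{a,γ}_loc`, with Hölder bounds on balls centred at the origin. -/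
def HolderDiff (a : ℕ) (γ : ℝ) (V : E → F) : Prop :=
  ContDiff ℝ a V ∧ BallHolder γ (iteratedFDeriv ℝ a V)

theorem HolderDiff.fderiv {a : ℕ} {γ : ℝ} {V : E → F} (h : HolderDiff (a + 1) γ V) :
    HolderDiff a γ (fderiv ℝ V) := by
  refine ⟨h.1.fderiv_right (m := a) (by norm_cast), fun ρ => ?_⟩
  obtain ⟨C, hC0, hC⟩ := h.2 ρ
  refine ⟨C, hC0, fun x y hx hy => ?_⟩
  have := hC x y hx hy
  rwa [← dist_eq_norm, iteratedFDeriv_succ_eq_comp_right, iteratedFDeriv_succ_eq_comp_right,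
    Function.comp_apply, Function.comp_apply, LinearIsometryEquiv.dist_map, dist_eq_norm] at this

theorem HolderDiff.of_succ [FiniteDimensional ℝ E] {a : ℕ} {γ : ℝ} (hγ1 : γ ≤ 1) {V : E → F}
    (h : HolderDiff (a + 1) γ V) : HolderDiff a γ V :=
  ⟨h.1.of_le (by norm_cast; omega), ballHolder_of_contDiff hγ1
    (h.1.iteratedFDeriv_right (m := 1) (by norm_cast; omega))⟩

theorem HolderDiff.ballHolder {γ : ℝ} {V : E → F} (h : HolderDiff 0 γ V) : BallHolder γ V := by
  intro ρ
  obtain ⟨C, hC0, hC⟩ := h.2 ρ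
  refine ⟨C, hC0, fun x y hx hy => ?_⟩
  have := hC x y hx hy
  rwa [iteratedFDeriv_zero_eq_comp, Function.comp_apply, Function.comp_apply, ← map_sub,
    LinearIsometryEquiv.norm_map] at this

theorem HolderDiff.secondDiffBound [FiniteDimensional ℝ E] {a k : ℕ} (ha : a ≤ 1) {γ : ℝ}
    (hγ0 : 0 ≤ γ) (hγ1 : γ ≤ 1) {V : E → F} (h : HolderDiff (k + a) γ V) :
    SecondDiffBound (a + γ) V := by
  induction k with
  | zero =>
    interval_cases a
    · simpa using h.ballHolder.secondDiffBound
    · simpa using h.fderiv.ballHolder.secondDiffBound_one_add hγ0 (h.1.differentiable (by simp))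
  | succ k ih =>
    rw [Nat.add_right_comm] at h
    exact ih (h.of_succ hγ1)

theorem hasFDerivAt_secondDiff {V : E → F} (hV : Differentiable ℝ V) (x z : E) :
    HasFDerivAt (fun x => secondDiff V x z) (secondDiff (fderiv ℝ V) x z) x := by
  have h1 : HasFDerivAt (fun x => V (x + z)) (fderiv ℝ V (x + z)) x :=
    (hV (x + z)).hasFDerivAt.comp x ((hasFDerivAt_id (𝕜 := ℝ) x).add_const z)
  have h2 : HasFDerivAt (fun x => V (x - z)) (fderiv ℝ V (x - z)) x :=
    (hV (x - z)).hasFDerivAt.comp x ((hasFDerivAt_id (𝕜 := ℝ) x).sub_const z)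
  exact ((hV x).hasFDerivAt.sub h1).add ((hV x).hasFDerivAt.sub h2)

end SecondDifferences

/-! ### Regularity of the near field -/

section NearField

variable {E : Type} [NormedAddCommGroup E] [InnerProductSpace ℝ E]
  {F : Type} [NormedAddCommGroup F] [NormedSpace ℝ F]

theorem norm_nearKernel_smul_secondDiff_le {β s : ℝ} {V : E → F} (hs : SecondDiffBound s V)
    (ρ : ℝ) : ∃ C, 0 ≤ C ∧ ∀ x z : E, ‖x‖ ≤ ρ →
      ‖nearKernel β z • secondDiff V x z‖ ≤ C * (nearKernel β z * ‖z‖ ^ s) := by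
  obtain ⟨C, hC0, hC⟩ := hs ρ
  refine ⟨C, hC0, fun x z hx => ?_⟩
  rw [norm_smul, Real.norm_of_nonneg (nearKernel_nonneg β z)]
  rcases le_total ‖z‖ 2 with hz | hz
  · calc _ ≤ nearKernel β z * (C * ‖z‖ ^ s) :=
          mul_le_mul_of_nonneg_left (hC x z hx hz) (nearKernel_nonneg β z)
      _ = _ := by ring
  · simp [nearKernel_eq_zero β hz]

variable [FiniteDimensional ℝ E] [MeasurableSpace E] [BorelSpace E]

theorem aestronglyMeasurable_nearKernel_smul_secondDiff (β : ℝ) {V : E → F} (hV : Continuous V)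
    (x : E) : AEStronglyMeasurable fun z => nearKernel β z • secondDiff V x z :=
  (measurable_nearKernel β).aestronglyMeasurable.smul
    (continuous_secondDiff_right hV x).aestronglyMeasurable

variable [Nontrivial E]

theorem continuous_integral_nearKernel_smul {β s : ℝ} (hβ : β < finrank ℝ E + s) {V : E → F}
    (hV : Continuous V) (hs : SecondDiffBound s V) :
    Continuous fun x => ∫ z, nearKernel β z • secondDiff V x z := by
  rw [continuous_iff_continuousAt]
  intro x₀
  obtain ⟨C, -, hC⟩ := norm_nearKernel_smul_secondDiff_le (β := β) hs (‖x₀‖ + 1)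
  refine continuousAt_of_dominated
    (bound := fun z => C * (nearKernel β z * ‖z‖ ^ s)) ?_ ?_ ?_ ?_
  · exact Eventually.of_forall fun x => aestronglyMeasurable_nearKernel_smul_secondDiff β hV x
  · filter_upwards [Metric.ball_mem_nhds x₀ zero_lt_one] with x hx
    exact Eventually.of_forall fun z => hC x z (norm_le_of_mem_ball_one hx)
  · exact (integrable_nearKernel_mul_rpow hβ).const_mul C
  · refine Eventually.of_forall fun z => Continuous.continuousAt ?_
    unfold secondDiff
    fun_prop

theorem hasFDerivAt_integral_nearKernel_smul {β s : ℝ} (hβ : β < finrank ℝ E + s) {V : E → F}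
    (hV : ContDiff ℝ 1 V) (hs : SecondDiffBound s V) (hs' : SecondDiffBound s (fderiv ℝ V))
    (x₀ : E) : HasFDerivAt (fun x => ∫ z, nearKernel β z • secondDiff V x z)
      (∫ z, nearKernel β z • secondDiff (fderiv ℝ V) x₀ z) x₀ := by
  obtain ⟨C, -, hC⟩ := norm_nearKernel_smul_secondDiff_le (β := β) hs (‖x₀‖ + 1)
  obtain ⟨C', -, hC'⟩ := norm_nearKernel_smul_secondDiff_le (β := β) hs' (‖x₀‖ + 1)
  have hint := integrable_nearKernel_mul_rpow (E := E) hβ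
  refine hasFDerivAt_integral_of_dominated_of_fderiv_le (𝕜 := ℝ)
    (F' := fun x z => nearKernel β z • secondDiff (fderiv ℝ V) x z)
    (Metric.ball_mem_nhds x₀ zero_lt_one)
    (bound := fun z => C' * (nearKernel β z * ‖z‖ ^ s)) ?_ ?_ ?_ ?_ ?_ ?_
  · exact Eventually.of_forall fun x =>
      aestronglyMeasurable_nearKernel_smul_secondDiff β hV.continuous x
  · exact (hint.const_mul C).mono'
      (aestronglyMeasurable_nearKernel_smul_secondDiff β hV.continuous x₀)
      (Eventually.of_forall fun z => hC x₀ z (by linarith))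
  · exact aestronglyMeasurable_nearKernel_smul_secondDiff β
      (hV.continuous_fderiv (by norm_num)) x₀
  · exact Eventually.of_forall fun z x hx => hC' x z (norm_le_of_mem_ball_one hx)
  · exact hint.const_mul C'
  · exact Eventually.of_forall fun z x _ =>
      (hasFDerivAt_secondDiff (hV.differentiable (by norm_num)) x z).const_smul (nearKernel β z)

/-- The near-field part of the fractional Laplacian loses `a + γ` derivatives, the order of the
second differences that the singular kernel needs. -/
theorem HolderDiff.contDiff_integral_nearKernel {a : ℕ} (ha : a ≤ 1) {β γ : ℝ} (hγ0 : 0 ≤ γ)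
    (hγ1 : γ ≤ 1) (hβ : β < finrank ℝ E + (a + γ)) (k : ℕ) {F : Type} [NormedAddCommGroup F]
    [NormedSpace ℝ F] {V : E → F} (h : HolderDiff (k + a) γ V) :
    ContDiff ℝ k fun x => ∫ z, nearKernel β z • secondDiff V x z := by
  -- The target space varies in the induction, which passes from `V` to `fderiv ℝ V`.
  induction k generalizing F with
  | zero =>
    exact contDiff_zero.2 (continuous_integral_nearKernel_smul hβ h.1.continuous
      (h.secondDiffBound ha hγ0 hγ1))
  | succ k ih =>
    have hs := h.secondDiffBound ha hγ0 hγ1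
    rw [Nat.add_right_comm] at h
    have hd := hasFDerivAt_integral_nearKernel_smul hβ (h.1.of_le (by norm_cast; omega))
      hs (h.fderiv.secondDiffBound ha hγ0 hγ1)
    rw [Nat.cast_succ, contDiff_succ_iff_fderiv]
    refine ⟨fun x => (hd x).differentiableAt, by simp, ?_⟩
    rw [show _root_.fderiv ℝ (fun x => ∫ z, nearKernel β z • secondDiff V x z) =
      fun x => ∫ z, nearKernel β z • secondDiff (_root_.fderiv ℝ V) x z from
      funext fun x => (hd x).fderiv]
    exact ih h.fderiv

end NearField

/-! ### The second-difference integral and the principal value -/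

section SingularIntegral

variable {E : Type} [NormedAddCommGroup E] [InnerProductSpace ℝ E]

theorem norm_rpow_mul_eq_near_add_far (β : ℝ) (z : E) (t : ℝ) :
    ‖z‖ ^ (-β) * t = nearKernel β z • t + farKernel β z * t := by
  rw [smul_eq_mul, ← add_mul, nearKernel_add_farKernel]

theorem farKernel_mul_secondDiff (β : ℝ) (u : E → ℝ) (x z : E) :
    farKernel β z * secondDiff u x z = 2 * u x * farKernel β z -
      farKernel β z * u (x + z) - farKernel β (-z) * u (x + -z) := by
  rw [farKernel_neg, secondDiff, sub_eq_add_neg x z]; ring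

variable [FiniteDimensional ℝ E]

/-- The far field is dominated by a translate of the weighted `L¹` density of `u`, locally uniformly
in the translation. -/
theorem exists_far_mul_le {β : ℝ} (hβ : 0 ≤ β) (u : E → ℝ) (ρ : ℝ) :
    ∃ C, 0 ≤ C ∧ ∀ x z : E, ‖x‖ ≤ ρ →
      ‖farKernel β z * u (x + z)‖ ≤ C * (|u (x + z)| / (1 + ‖x + z‖ ^ β)) := by
  obtain ⟨C, hC0, hC⟩ := (asympHomogeneous_farKernel (E := E) β).exists_norm_le hβ
  obtain ⟨A, hA, hw⟩ := exists_inv_weight_le (E := E) hβ ρ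
  refine ⟨C * A, by positivity, fun x z hx => ?_⟩
  have h := hw x (x + z) hx
  rw [add_sub_cancel_left] at h
  rw [norm_mul, Real.norm_eq_abs (u _)]
  calc _ ≤ C * (A * (1 + ‖x + z‖ ^ β)⁻¹) * |u (x + z)| := by
        gcongr
        exact (hC z).trans (by gcongr)
    _ = _ := by ring

variable [MeasurableSpace E] [BorelSpace E]

/-- The second-difference integral `∫ ‖z‖^(-β) (2 u x - u (x + z) - u (x - z)) dz`. For
`β = d + α` it converges absolutely and is twice the principal value that defines
`(-Δ)^{α/2} u x`, up to the normalizing constant. -/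
def singularIntegral (β : ℝ) (u : E → ℝ) (x : E) : ℝ := ∫ z, ‖z‖ ^ (-β) * secondDiff u x z

/-- Functions on which `singularIntegral β` converges absolutely when `d < β < d + s`: they are
continuous, have finite weighted `L¹` norm, and second differences of order `s`. -/
structure NonlocalDomain (β s : ℝ) (u : E → ℝ) : Prop where
  continuous : Continuous u
  integrable : Integrable fun y => |u y| / (1 + ‖y‖ ^ β)
  secondDiffBound : SecondDiffBound s u

theorem integrable_farKernel_mul {β : ℝ} (hβ : 0 ≤ β) {u : E → ℝ} (hu : Continuous u)
    (hw : Integrable fun y => |u y| / (1 + ‖y‖ ^ β)) (x : E) :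
    Integrable fun z => farKernel β z * u (x + z) := by
  obtain ⟨C, -, hC⟩ := exists_far_mul_le hβ u ‖x‖
  have hk := (contDiff_farKernel (E := E) β).continuous
  exact ((hw.comp_add_left x).const_mul C).mono'
    (Continuous.aestronglyMeasurable (by fun_prop)) (Eventually.of_forall fun z => hC x z le_rfl)

theorem integral_farKernel_mul (β : ℝ) (u : E → ℝ) (x : E) :
    ∫ z, farKernel β z * u (x + z) = ∫ y, u y • farKernel β (x - y) := by
  rw [← integral_sub_left_eq_self (fun y => u y • farKernel β (x - y)) volume x,
    ← integral_neg_eq_self]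
  simp [farKernel_neg, mul_comm, sub_eq_add_neg]

theorem integrable_farKernel_mul_secondDiff {β : ℝ} (hβ : (finrank ℝ E : ℝ) < β) {u : E → ℝ}
    (hu : Continuous u) (hw : Integrable fun y => |u y| / (1 + ‖y‖ ^ β)) (x : E) :
    Integrable fun z => farKernel β z * secondDiff u x z := by
  have hβ0 : 0 ≤ β := (Nat.cast_nonneg _).trans hβ.le
  have h := integrable_farKernel_mul hβ0 hu hw x
  simp_rw [farKernel_mul_secondDiff]
  exact (((integrable_farKernel hβ).const_mul _).sub h).sub h.comp_neg

theorem integral_farKernel_mul_secondDiff {β : ℝ} (hβ : (finrank ℝ E : ℝ) < β) {u : E → ℝ}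
    (hu : Continuous u) (hw : Integrable fun y => |u y| / (1 + ‖y‖ ^ β)) (x : E) :
    ∫ z, farKernel β z * secondDiff u x z = 2 * u x * (∫ z : E, farKernel β z) -
      2 * ∫ y, u y • farKernel β (x - y) := by
  have hβ0 : 0 ≤ β := (Nat.cast_nonneg _).trans hβ.le
  have h := integrable_farKernel_mul hβ0 hu hw x
  have h' : Integrable fun z => 2 * u x * farKernel β z - farKernel β z * u (x + z) :=
    ((integrable_farKernel hβ).const_mul _).sub h
  simp_rw [farKernel_mul_secondDiff]
  rw [integral_sub h' h.comp_neg, integral_sub ((integrable_farKernel hβ).const_mul _) h,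
    integral_const_mul,
    integral_neg_eq_self (fun z => farKernel β z * u (x + z)), integral_farKernel_mul]
  ring

variable [Nontrivial E]

theorem NonlocalDomain.integrable_near {β s : ℝ} (hβs : β < finrank ℝ E + s) {u : E → ℝ}
    (hu : NonlocalDomain β s u) (x : E) :
    Integrable fun z => nearKernel β z • secondDiff u x z := by
  obtain ⟨C, -, hC⟩ := norm_nearKernel_smul_secondDiff_le (β := β) hu.secondDiffBound ‖x‖
  exact ((integrable_nearKernel_mul_rpow hβs).const_mul C).mono'
    (aestronglyMeasurable_nearKernel_smul_secondDiff β hu.continuous x)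
    (Eventually.of_forall fun z => hC x z le_rfl)

theorem NonlocalDomain.integrable_mul_secondDiff {β s : ℝ} (hβ : (finrank ℝ E : ℝ) < β)
    (hβs : β < finrank ℝ E + s) {u : E → ℝ} (hu : NonlocalDomain β s u) (x : E) :
    Integrable fun z => ‖z‖ ^ (-β) * secondDiff u x z := by
  simp_rw [norm_rpow_mul_eq_near_add_far]
  exact (hu.integrable_near hβs x).add
    (integrable_farKernel_mul_secondDiff hβ hu.continuous hu.integrable x)

/-- The singular integral converges absolutely, locally uniformly. -/
theorem NonlocalDomain.exists_integral_norm_le {β s : ℝ} (hβ : (finrank ℝ E : ℝ) < β)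
    (hβs : β < finrank ℝ E + s) {u : E → ℝ} (hu : NonlocalDomain β s u) (ρ : ℝ) :
    ∃ C, ∀ x : E, ‖x‖ ≤ ρ → ∫ z, ‖‖z‖ ^ (-β) * secondDiff u x z‖ ≤ C := by
  have hβ0 : 0 ≤ β := (Nat.cast_nonneg _).trans hβ.le
  obtain ⟨C, -, hC⟩ := norm_nearKernel_smul_secondDiff_le (β := β) hu.secondDiffBound ρ
  obtain ⟨C', -, hC'⟩ := exists_far_mul_le hβ0 u ρ
  obtain ⟨M, hM⟩ := (isCompact_closedBall (0 : E) ρ).exists_bound_of_continuousOn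
    hu.continuous.continuousOn
  set h : E → ℝ := fun y => |u y| / (1 + ‖y‖ ^ β)
  have hfar0 : 0 ≤ ∫ z : E, farKernel β z := integral_nonneg (farKernel_nonneg β)
  refine ⟨C * (∫ z : E, nearKernel β z * ‖z‖ ^ s) + (2 * M * (∫ z : E, farKernel β z) +
    (C' * (∫ y, h y) + C' * ∫ y, h y)), fun x hx => ?_⟩
  have i1 := (integrable_nearKernel_mul_rpow (E := E) hβs).const_mul C
  have i2 := (integrable_farKernel hβ).const_mul (2 * |u x|)
  have i3 := (hu.integrable.comp_add_left x).const_mul C'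
  have i4 := i3.comp_neg
  have i34 : Integrable fun z => C' * h (x + z) + C' * h (x + -z) := i3.add i4
  have i234 : Integrable fun z => 2 * |u x| * farKernel β z +
      (C' * h (x + z) + C' * h (x + -z)) := i2.add i34
  calc ∫ z, ‖‖z‖ ^ (-β) * secondDiff u x z‖
      ≤ ∫ z, (C * (nearKernel β z * ‖z‖ ^ s) + (2 * |u x| * farKernel β z +
        (C' * h (x + z) + C' * h (x + -z)))) := by
        refine integral_mono (hu.integrable_mul_secondDiff hβ hβs x).norm
          (i1.add i234) fun z => ?_
        simp only [norm_rpow_mul_eq_near_add_far, farKernel_mul_secondDiff]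
        refine (norm_add_le _ _).trans (add_le_add (hC x z hx) ?_)
        refine (norm_sub_le _ _).trans ?_
        rw [← add_assoc]
        refine add_le_add ((norm_sub_le _ _).trans (add_le_add ?_ (hC' x z hx))) (hC' x (-z) hx)
        rw [norm_mul, norm_mul, Real.norm_of_nonneg (farKernel_nonneg β z), Real.norm_eq_abs,
          Real.norm_eq_abs, abs_two]
    _ = C * (∫ z : E, nearKernel β z * ‖z‖ ^ s) + (2 * |u x| * (∫ z : E, farKernel β z) +
        (C' * (∫ y, h y) + C' * ∫ y, h y)) := by
        rw [integral_add i1 i234, integral_add i2 i34, integral_add i3 i4,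
          integral_neg_eq_self (fun z => C' * h (x + z)), integral_const_mul, integral_const_mul,
          integral_const_mul, integral_add_left_eq_self h x]
    _ ≤ _ := by
        gcongr
        exact hM x (by simpa using hx)

/-- The singular integral of a function of class `C^{k+a,γ}` is of class `C^k`. -/
theorem contDiff_singularIntegral {a : ℕ} (ha : a ≤ 1) {β γ : ℝ} (hβ : (finrank ℝ E : ℝ) < β)
    (hγ0 : 0 ≤ γ) (hγ1 : γ ≤ 1) (hβs : β < finrank ℝ E + (a + γ)) {k : ℕ} {u : E → ℝ}
    (h : HolderDiff (k + a) γ u) (hw : Integrable fun y => |u y| / (1 + ‖y‖ ^ β)) :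
    ContDiff ℝ k (singularIntegral β u) := by
  have hβ0 : 0 ≤ β := (Nat.cast_nonneg _).trans hβ.le
  have hc : Continuous u := h.1.continuous
  have hu : NonlocalDomain β (a + γ) u := ⟨hc, hw, h.secondDiffBound ha hγ0 hγ1⟩
  have heq : singularIntegral β u = fun x => (∫ z, nearKernel β z • secondDiff u x z) +
      (2 * u x * (∫ z : E, farKernel β z) - 2 * ∫ y, u y • farKernel β (x - y)) := by
    ext x
    simp_rw [singularIntegral, norm_rpow_mul_eq_near_add_far]
    rw [integral_add (hu.integrable_near hβs x) (integrable_farKernel_mul_secondDiff hβ hc hw x),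
      integral_farKernel_mul_secondDiff hβ hc hw]
  have huk : ContDiff ℝ k u := h.1.of_le (by norm_cast; omega)
  rw [heq]
  exact (h.contDiff_integral_nearKernel ha hγ0 hγ1 hβs k).add
    (((contDiff_const.mul huk).mul contDiff_const).sub (contDiff_const.mul
      (contDiff_integral_smul_farField hβ0 hw hc.aestronglyMeasurable k
        (asympHomogeneous_farKernel β))))

/-- The truncated integrals of the principal value converge to half of the second-difference
integral, by the symmetry `z ↦ -z` of the truncated domain. -/
theorem NonlocalDomain.tendsto_truncated {β s : ℝ} (hβ : (finrank ℝ E : ℝ) < β)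
    (hβs : β < finrank ℝ E + s) {u : E → ℝ} (hu : NonlocalDomain β s u) (x : E) :
    Tendsto (fun ε : ℝ => ∫ y in {y : E | ε ≤ ‖y - x‖}, (u x - u y) / ‖x - y‖ ^ β) (𝓝[>] 0)
      (𝓝 (singularIntegral β u x / 2)) := by
  have hβ0 : 0 < β := (Nat.cast_nonneg _).trans_lt hβ
  have hc := hu.continuous
  have hms : ∀ ε : ℝ, MeasurableSet {z : E | ε ≤ ‖z‖} := fun ε =>
    measurableSet_le measurable_const measurable_norm
  have hfull := hu.integrable_mul_secondDiff hβ hβs x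
  set g : ℝ → E → ℝ := fun ε => {z : E | ε ≤ ‖z‖}.indicator
    fun z => ‖z‖ ^ (-β) * (u x - u (x + z)) with hg
  have hgint : ∀ ε, 0 < ε → Integrable (g ε) := by
    intro ε hε
    obtain ⟨A, hA, hw⟩ := exists_inv_weight_le (E := E) hβ0.le ‖x‖
    set B := ε ^ (-β) + 1
    have hB : 0 < B := by positivity
    refine (((integrable_inv_weight hβ).const_mul (B * |u x|)).add
      ((hu.integrable.comp_add_left x).const_mul (B * A))).mono'
      ((Measurable.aestronglyMeasurable (by fun_prop)).indicator (hms ε))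
      (Eventually.of_forall fun z => ?_)
    by_cases hz : z ∈ {z : E | ε ≤ ‖z‖}
    · have hz' : ε ≤ ‖z‖ := hz
      have hz0 : 0 < ‖z‖ := hε.trans_le hz'
      have h1 : ‖z‖ ^ (-β) ≤ B * (1 + ‖z‖ ^ β)⁻¹ := by
        rw [← div_eq_mul_inv, le_div_iff₀ (by positivity), mul_add, ← Real.rpow_add hz0]
        simpa [B] using Real.rpow_le_rpow_of_nonpos hε hz' (by linarith : -β ≤ 0)
      have h2 := hw x (x + z) le_rfl
      rw [add_sub_cancel_left] at h2
      simp only [hg, Set.indicator_of_mem hz, norm_mul, Real.norm_eq_abs, Pi.add_apply]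
      rw [abs_of_nonneg (by positivity : 0 ≤ ‖z‖ ^ (-β))]
      calc _ ≤ B * (1 + ‖z‖ ^ β)⁻¹ * (|u x| + |u (x + z)|) := by
            gcongr
            exact abs_sub _ _
        _ = B * |u x| * (1 + ‖z‖ ^ β)⁻¹ + B * ((1 + ‖z‖ ^ β)⁻¹ * |u (x + z)|) := by ring
        _ ≤ B * |u x| * (1 + ‖z‖ ^ β)⁻¹ +
            B * (A * (1 + ‖x + z‖ ^ β)⁻¹ * |u (x + z)|) := by gcongr
        _ = _ := by ring
    · simp only [hg, Set.indicator_of_notMem hz, norm_zero, Pi.add_apply]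
      positivity
  have htrunc : ∀ ε, 0 < ε → ∫ y in {y : E | ε ≤ ‖y - x‖}, (u x - u y) / ‖x - y‖ ^ β =
      (∫ z, {z : E | ε ≤ ‖z‖}.indicator (fun z => ‖z‖ ^ (-β) * secondDiff u x z) z) / 2 := by
    intro ε hε
    have h1 : ∫ y in {y : E | ε ≤ ‖y - x‖}, (u x - u y) / ‖x - y‖ ^ β = ∫ z, g ε z := by
      rw [← integral_indicator (measurableSet_le measurable_const (by fun_prop)),
        ← integral_add_left_eq_self _ x]
      congr 1 with z
      simp only [hg, Set.indicator, Set.mem_ofPred_eq, add_sub_cancel_left]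
      rw [Real.rpow_neg (norm_nonneg z), div_eq_inv_mul, sub_add_cancel_left, norm_neg]
    have h2 : ∫ z, {z : E | ε ≤ ‖z‖}.indicator (fun z => ‖z‖ ^ (-β) * secondDiff u x z) z =
        ∫ z, (g ε z + g ε (-z)) := by
      congr 1 with z
      by_cases hz : ε ≤ ‖z‖
      · simp only [hg, Set.indicator, Set.mem_ofPred_eq, norm_neg, hz, if_true, secondDiff,
          ← sub_eq_add_neg]
        ring
      · simp [hg, Set.indicator, hz]
    rw [h1, h2, integral_add (hgint ε hε) (hgint ε hε).comp_neg, integral_neg_eq_self (g ε)]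
    ring
  have hlim : Tendsto (fun ε : ℝ => ∫ z, {z : E | ε ≤ ‖z‖}.indicator
      (fun z => ‖z‖ ^ (-β) * secondDiff u x z) z) (𝓝[>] 0) (𝓝 (singularIntegral β u x)) := by
    refine tendsto_integral_filter_of_dominated_convergence _
      (Eventually.of_forall fun ε => hfull.aestronglyMeasurable.indicator (hms ε))
      (Eventually.of_forall fun ε => Eventually.of_forall fun z => norm_indicator_le_norm_self _ _)
      hfull.norm (Eventually.of_forall fun z => ?_)
    by_cases hz : z = 0
    · -- Both sides vanish at the origin, where `0 ^ (-β) = 0`.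
      subst hz
      refine tendsto_const_nhds.congr fun ε => ?_
      simp [Set.indicator, secondDiff]
    · refine tendsto_const_nhds.congr' ?_
      filter_upwards [mem_nhdsWithin_of_mem_nhds (Iio_mem_nhds (norm_pos_iff.2 hz))] with ε hε
      have hlt : ε < ‖z‖ := hε
      rw [Set.indicator_of_mem]
      exact hlt.le
  refine (hlim.div_const 2).congr' ?_
  filter_upwards [self_mem_nhdsWithin] with ε hε using (htrunc ε hε).symm

end SingularIntegral

/-! ### Symmetry of the singular integral and vanishing means -/

section Duality

variable {E : Type} [NormedAddCommGroup E] [InnerProductSpace ℝ E] [FiniteDimensional ℝ E]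

theorem holderDiff_of_contDiff {φ : E → ℝ} (hφ : ContDiff ℝ 2 φ) : HolderDiff 1 1 φ :=
  ⟨hφ.of_le (by norm_num), ballHolder_of_contDiff le_rfl
    (hφ.iteratedFDeriv_right (m := 1) (by norm_num))⟩

variable [MeasurableSpace E] [BorelSpace E]

theorem integrable_weight_of_hasCompactSupport (β : ℝ) {φ : E → ℝ}
    (hφ : Continuous φ) (hφs : HasCompactSupport φ) :
    Integrable fun y => |φ y| / (1 + ‖y‖ ^ β) := by
  refine (hφ.integrable_of_hasCompactSupport hφs).norm.mono'
    (Measurable.aestronglyMeasurable (by fun_prop)) (Eventually.of_forall fun y => ?_)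
  have h : 0 ≤ ‖y‖ ^ β := by positivity
  rw [Real.norm_of_nonneg (by positivity), Real.norm_eq_abs]
  exact div_le_self (abs_nonneg _) (by linarith)

theorem nonlocalDomain_of_hasCompactSupport (β : ℝ) {φ : E → ℝ}
    (hφ : ContDiff ℝ 2 φ) (hφs : HasCompactSupport φ) : NonlocalDomain β 2 φ := by
  refine ⟨hφ.continuous, integrable_weight_of_hasCompactSupport β hφ.continuous hφs, ?_⟩
  have := HolderDiff.secondDiffBound (k := 0) le_rfl zero_le_one le_rfl (holderDiff_of_contDiff hφ)
  norm_num at this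
  exact this

/-- A translation invariant measure sees the second difference as a symmetric operator. -/
theorem integral_secondDiff_mul {u φ : E → ℝ} (hu : Continuous u) (hφ : Continuous φ)
    (hφs : HasCompactSupport φ) (z : E) :
    ∫ x, secondDiff u x z * φ x = ∫ x, u x * secondDiff φ x z := by
  have i : ∀ {f g : E → ℝ}, Continuous f → Continuous g → HasCompactSupport g →
      Integrable fun x => f x * g x := fun hf hg hgs =>
    (hf.mul hg).integrable_of_hasCompactSupport hgs.mul_left
  have hs : ∀ v : E, HasCompactSupport fun x => φ (x + v) := fun v =>
    hφs.comp_homeomorph (Homeomorph.addRight v)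
  have hshift : ∀ v : E, ∫ x, u (x + v) * φ x = ∫ x, u x * φ (x + -v) := fun v => by
    rw [← integral_add_right_eq_self (fun x => u x * φ (x + -v)) v]
    simp
  have j1 := i hu hφ hφs
  have j2 : ∀ v : E, Integrable fun x => u (x + v) * φ x := fun v => i (by fun_prop) hφ hφs
  have j3 : ∀ v : E, Integrable fun x => u x * φ (x + v) := fun v => i hu (by fun_prop) (hs v)
  have k2 : ∀ v : E, Integrable fun x => u x * φ x - u (x + v) * φ x := fun v => j1.sub (j2 v)
  have k3 : ∀ v : E, Integrable fun x => u x * φ x - u x * φ (x + v) := fun v => j1.sub (j3 v)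
  have e1 : ∫ x, secondDiff u x z * φ x =
      ∫ x, ((u x * φ x - u (x + z) * φ x) + (u x * φ x - u (x + -z) * φ x)) := by
    congr 1 with x; rw [secondDiff, sub_eq_add_neg x z]; ring
  have e2 : ∫ x, u x * secondDiff φ x z =
      ∫ x, ((u x * φ x - u x * φ (x + z)) + (u x * φ x - u x * φ (x + -z))) := by
    congr 1 with x; rw [secondDiff, sub_eq_add_neg x z]; ring
  rw [e1, e2, integral_add (k2 z) (k2 (-z)), integral_add (k3 z) (k3 (-z)), integral_sub j1 (j2 z),
    integral_sub j1 (j2 (-z)), integral_sub j1 (j3 z), integral_sub j1 (j3 (-z)), hshift z,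
    hshift (-z), neg_neg]
  ring

theorem singularIntegral_comp_dilation (β : ℝ) (φ : E → ℝ) (x₀ x : E) {R : ℝ} (hR : 0 < R) :
    singularIntegral β (fun y => φ (R⁻¹ • (y - x₀))) x =
      R ^ finrank ℝ E * (R ^ (-β) * singularIntegral β φ (R⁻¹ • (x - x₀))) := by
  have h := Measure.integral_comp_inv_smul (volume : Measure E)
    (fun z => ‖R • z‖ ^ (-β) * secondDiff φ (R⁻¹ • (x - x₀)) z) R
  rw [abs_of_nonneg (by positivity), smul_eq_mul] at h
  rw [singularIntegral, singularIntegral, ← integral_const_mul (R ^ (-β))]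
  convert h using 2
  · ext z
    rw [smul_inv_smul₀ hR.ne', secondDiff, secondDiff, ← smul_add, ← smul_sub,
      add_sub_right_comm x z x₀, sub_right_comm x z x₀]
  · congr 1 with z
    rw [norm_smul, Real.norm_of_nonneg hR.le, Real.mul_rpow hR.le (norm_nonneg z), mul_assoc]

variable [Nontrivial E]

/-- The singular integral of a test function decays like `‖x‖^(-β)`. -/
theorem exists_integral_norm_le_weight {β : ℝ} (hβ : (finrank ℝ E : ℝ) < β)
    (hβ2 : β < finrank ℝ E + 2) {φ : E → ℝ} (hφ : ContDiff ℝ 2 φ) (hφs : HasCompactSupport φ) :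
    ∃ A, 0 ≤ A ∧ ∀ x : E,
      ∫ z, ‖‖z‖ ^ (-β) * secondDiff φ x z‖ ≤ A * (1 + ‖x‖ ^ β)⁻¹ := by
  have hβ0 : 0 < β := (Nat.cast_nonneg _).trans_lt hβ
  have hdom := nonlocalDomain_of_hasCompactSupport β hφ hφs
  obtain ⟨ρ, hρ, hsupp⟩ : ∃ ρ, 1 ≤ ρ ∧ tsupport φ ⊆ Metric.closedBall 0 ρ := by
    obtain ⟨r, hr⟩ := (Metric.isBounded_iff_subset_closedBall (0 : E)).1 hφs.isBounded
    exact ⟨max r 1, le_max_right _ _,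
      hr.trans (Metric.closedBall_subset_closedBall (le_max_left _ _))⟩
  have hzero : ∀ y : E, ρ < ‖y‖ → φ y = 0 := fun y hy =>
    image_eq_zero_of_notMem_tsupport fun h => by
      have := hsupp h
      rw [mem_closedBall_zero_iff] at this
      linarith
  obtain ⟨C, hC⟩ := hdom.exists_integral_norm_le hβ hβ2 (2 * ρ)
  have hφi : Integrable fun y => |φ y| := (hφ.continuous.integrable_of_hasCompactSupport hφs).abs
  set I := ∫ y, |φ y|
  have hI : 0 ≤ I := integral_nonneg fun _ => abs_nonneg _
  have h2ρ : 0 ≤ (2 * ρ) ^ β := by positivity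
  refine ⟨|C| * (1 + (2 * ρ) ^ β) + 4 * 2 ^ β * I, by positivity, fun x => ?_⟩
  have hxβ : 0 ≤ ‖x‖ ^ β := by positivity
  rw [← div_eq_mul_inv, le_div_iff₀ (by positivity)]
  rcases le_or_gt ‖x‖ (2 * ρ) with hx | hx
  · calc _ ≤ |C| * (1 + (2 * ρ) ^ β) := by
          gcongr
          exact (hC x hx).trans (le_abs_self C)
      _ ≤ _ := le_add_of_nonneg_right (by positivity)
  · have hx0 : 0 < ‖x‖ := by linarith
    have hx1 : 1 ≤ ‖x‖ ^ β := Real.one_le_rpow (by linarith) hβ0.le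
    -- Only steps with `‖z‖ ≥ ‖x‖ / 2` reach the support of `φ`.
    have hpt : ∀ z y : E, ‖x‖ - ‖z‖ ≤ ‖y‖ → ‖z‖ ^ (-β) * |φ y| ≤ (‖x‖ / 2) ^ (-β) * |φ y| := by
      intro z y hy
      rcases le_or_gt ‖y‖ ρ with h | h
      · gcongr ?_ * _
        exact Real.rpow_le_rpow_of_nonpos (by positivity) (by linarith) (by linarith)
      · simp [hzero y h]
    have hle : ∫ z, ‖‖z‖ ^ (-β) * secondDiff φ x z‖ ≤
        ∫ z, ((‖x‖ / 2) ^ (-β) * |φ (x + z)| + (‖x‖ / 2) ^ (-β) * |φ (x + -z)|) := by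
      refine integral_mono (hdom.integrable_mul_secondDiff hβ hβ2 x).norm
        (((hφi.comp_add_left x).const_mul _).add
          ((hφi.comp_add_left x).const_mul _).comp_neg) fun z => ?_
      have h1 := hpt z (x + z) (by simpa using norm_sub_norm_le x (-z))
      have h2 := hpt z (x + -z) (by
        rw [← sub_eq_add_neg]; exact norm_sub_norm_le x z)
      have h3 : |secondDiff φ x z| ≤ |φ (x + z)| + |φ (x + -z)| := by
        rw [secondDiff, hzero x (by linarith), sub_eq_add_neg x z, zero_sub, zero_sub]
        exact (abs_add_le _ _).trans_eq (by rw [abs_neg, abs_neg])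
      simp only [norm_mul, Real.norm_eq_abs]
      rw [abs_of_nonneg (by positivity : 0 ≤ ‖z‖ ^ (-β))]
      calc _ ≤ ‖z‖ ^ (-β) * (|φ (x + z)| + |φ (x + -z)|) := by gcongr
        _ ≤ _ := by rw [mul_add]; exact add_le_add h1 h2
    have heq : ∫ z, ((‖x‖ / 2) ^ (-β) * |φ (x + z)| + (‖x‖ / 2) ^ (-β) * |φ (x + -z)|) =
        2 * (‖x‖ / 2) ^ (-β) * I := by
      have i1 := (hφi.comp_add_left x).const_mul ((‖x‖ / 2) ^ (-β))
      rw [integral_add i1 i1.comp_neg,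
        integral_neg_eq_self (fun z => (‖x‖ / 2) ^ (-β) * |φ (x + z)|), integral_const_mul,
        integral_add_left_eq_self (fun y => |φ y|) x]
      ring
    have hpow : (‖x‖ / 2) ^ (-β) * ‖x‖ ^ β = 2 ^ β := by
      rw [Real.rpow_neg (by positivity), Real.div_rpow hx0.le zero_le_two]
      field_simp
    calc _ ≤ 2 * (‖x‖ / 2) ^ (-β) * I * (1 + ‖x‖ ^ β) := by
          gcongr
          exact hle.trans_eq heq
      _ ≤ 2 * (‖x‖ / 2) ^ (-β) * I * (2 * ‖x‖ ^ β) := by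
          gcongr
          linarith
      _ = 4 * 2 ^ β * I := by rw [← hpow]; ring
      _ ≤ _ := le_add_of_nonneg_left (by positivity)

/-- The singular integral operator is symmetric with respect to test functions. -/
theorem NonlocalDomain.integral_singularIntegral_mul {β s : ℝ} (hβ : (finrank ℝ E : ℝ) < β)
    (hβs : β < finrank ℝ E + s) (hβ2 : β < finrank ℝ E + 2) {u φ : E → ℝ}
    (hu : NonlocalDomain β s u) (hφ : ContDiff ℝ 2 φ) (hφs : HasCompactSupport φ) :
    ∫ x, singularIntegral β u x * φ x = ∫ x, u x * singularIntegral β φ x := by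
  have hβ0 : 0 < β := (Nat.cast_nonneg _).trans_lt hβ
  have hdom := nonlocalDomain_of_hasCompactSupport β hφ hφs
  have hc := hu.continuous
  have hφc := hφ.continuous
  have hmeas : ∀ {v : E → ℝ}, Continuous v →
      Measurable fun q : E × E => ‖q.2‖ ^ (-β) * secondDiff v q.1 q.2 := by
    intro v hv
    have : Continuous fun q : E × E => secondDiff v q.1 q.2 := by unfold secondDiff; fun_prop
    exact Measurable.mul (by fun_prop) this.measurable
  have h1 : Integrable (Function.uncurry fun x z => ‖z‖ ^ (-β) * secondDiff u x z * φ x)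
      ((volume : Measure E).prod volume) := by
    have hm : AEStronglyMeasurable
        (Function.uncurry fun x z => ‖z‖ ^ (-β) * secondDiff u x z * φ x)
        ((volume : Measure E).prod volume) :=
      ((hmeas hc).mul (hφc.measurable.comp measurable_fst)).aestronglyMeasurable
    rw [integrable_prod_iff hm]
    refine ⟨Eventually.of_forall fun x =>
      (hu.integrable_mul_secondDiff hβ hβs x).mul_const (φ x), ?_⟩
    obtain ⟨ρ, hsupp⟩ := (Metric.isBounded_iff_subset_closedBall (0 : E)).1 hφs.isBounded
    obtain ⟨C, hC⟩ := hu.exists_integral_norm_le hβ hβs ρ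
    refine ((hφc.integrable_of_hasCompactSupport hφs).norm.const_mul C).mono'
      hm.norm.integral_prod_right' (Eventually.of_forall fun x => ?_)
    rw [Real.norm_of_nonneg (integral_nonneg fun _ => norm_nonneg _)]
    simp only [Function.uncurry_apply_pair, norm_mul _ (φ x)]
    rw [integral_mul_const]
    by_cases hx : x ∈ tsupport φ
    · gcongr
      exact hC x (by simpa using hsupp hx)
    · simp [image_eq_zero_of_notMem_tsupport hx]
  have h2 : Integrable (Function.uncurry fun x z => u x * (‖z‖ ^ (-β) * secondDiff φ x z))
      ((volume : Measure E).prod volume) := by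
    have hm : AEStronglyMeasurable
        (Function.uncurry fun x z => u x * (‖z‖ ^ (-β) * secondDiff φ x z))
        ((volume : Measure E).prod volume) :=
      ((hc.measurable.comp measurable_fst).mul (hmeas hφc)).aestronglyMeasurable
    rw [integrable_prod_iff hm]
    refine ⟨Eventually.of_forall fun x =>
      (hdom.integrable_mul_secondDiff hβ hβ2 x).const_mul (u x), ?_⟩
    obtain ⟨A, -, hA⟩ := exists_integral_norm_le_weight hβ hβ2 hφ hφs
    refine (hu.integrable.const_mul A).mono'
      hm.norm.integral_prod_right' (Eventually.of_forall fun x => ?_)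
    rw [Real.norm_of_nonneg (integral_nonneg fun _ => norm_nonneg _)]
    simp only [Function.uncurry_apply_pair, norm_mul (u x)]
    rw [integral_const_mul, Real.norm_eq_abs (u x)]
    calc _ ≤ |u x| * (A * (1 + ‖x‖ ^ β)⁻¹) := by gcongr; exact hA x
      _ = _ := by ring
  simp_rw [singularIntegral, ← integral_mul_const, ← integral_const_mul]
  rw [integral_integral_swap h1, integral_integral_swap h2]
  congr 1 with z
  simp_rw [mul_assoc, mul_left_comm (u _)]
  rw [integral_const_mul, integral_const_mul, integral_secondDiff_mul hc hφc hφs]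

/-- The means of `(-Δ)^{α/2} u` vanish at large scales: on a test function dilated by `R` they are
at most a multiple of `∫ |u x| / (R^β + ‖x - x₀‖^β) dx`. -/
theorem NonlocalDomain.vanishingMeans_singularIntegral {β s : ℝ} (hβ : (finrank ℝ E : ℝ) < β)
    (hβs : β < finrank ℝ E + s) (hβ2 : β < finrank ℝ E + 2) {u : E → ℝ}
    (hu : NonlocalDomain β s u) : VanishingMeans (singularIntegral β u) := by
  intro φ hφ hφs x₀
  have hβ0 : 0 < β := (Nat.cast_nonneg _).trans_lt hβ
  have hφ2 : ContDiff ℝ 2 φ := contDiff_infty.1 hφ 2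
  have hTc : Continuous (singularIntegral β φ) :=
    (contDiff_singularIntegral (k := 0) le_rfl hβ zero_le_one le_rfl
      (by push_cast; linarith) (holderDiff_of_contDiff hφ2)
      (integrable_weight_of_hasCompactSupport β hφ2.continuous hφs)).continuous
  obtain ⟨A, hA0, hA⟩ := exists_integral_norm_le_weight hβ hβ2 hφ2 hφs
  have hrew : ∀ R : ℝ, 0 < R → ∫ z, singularIntegral β u (x₀ + R • z) * φ z =
      ∫ x, R ^ (-β) * (u x * singularIntegral β φ (R⁻¹ • (x - x₀))) := by
    intro R hR
    have hφR : ContDiff ℝ 2 fun y => φ (R⁻¹ • (y - x₀)) := by fun_prop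
    have hφRs : HasCompactSupport fun y => φ (R⁻¹ • (y - x₀)) :=
      hφs.comp_homeomorph ((Homeomorph.subRight x₀).trans (Homeomorph.smulOfNeZero R⁻¹
        (inv_ne_zero hR.ne')))
    have h1 := integral_comp_add_smul
      (fun x => singularIntegral β u x * φ (R⁻¹ • (x - x₀))) x₀ hR
    simp only [add_sub_cancel_left, inv_smul_smul₀ hR.ne'] at h1
    rw [h1, hu.integral_singularIntegral_mul hβ hβs hβ2 hφR hφRs, ← integral_const_mul]
    congr 1 with x
    rw [singularIntegral_comp_dilation β φ x₀ x hR]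
    field_simp
  have hbound : ∀ R : ℝ, 0 < R → ∀ x : E,
      ‖R ^ (-β) * (u x * singularIntegral β φ (R⁻¹ • (x - x₀)))‖ ≤
        A * |u x| * (R ^ β + ‖x - x₀‖ ^ β)⁻¹ := by
    intro R hR x
    have h1 : ‖singularIntegral β φ (R⁻¹ • (x - x₀))‖ ≤
        A * (1 + ‖R⁻¹ • (x - x₀)‖ ^ β)⁻¹ := (norm_integral_le_integral_norm _).trans (hA _)
    have hRβ : 0 < R ^ β := by positivity
    have h2 : R ^ (-β) * (1 + ‖R⁻¹ • (x - x₀)‖ ^ β)⁻¹ = (R ^ β + ‖x - x₀‖ ^ β)⁻¹ := by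
      rw [norm_smul, Real.norm_of_nonneg (by positivity), Real.mul_rpow (by positivity)
        (norm_nonneg _), Real.inv_rpow hR.le, Real.rpow_neg hR.le, ← mul_inv, mul_add, mul_one,
        mul_inv_cancel_left₀ hRβ.ne']
    rw [norm_mul, norm_mul, Real.norm_of_nonneg (by positivity : 0 ≤ R ^ (-β)), ← h2,
      Real.norm_eq_abs (u x)]
    calc _ ≤ R ^ (-β) * (|u x| * (A * (1 + ‖R⁻¹ • (x - x₀)‖ ^ β)⁻¹)) := by gcongr
      _ = _ := by ring
  obtain ⟨A', hA', hw⟩ := exists_inv_weight_le (E := E) hβ0.le ‖x₀‖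
  suffices Tendsto (fun R : ℝ => ∫ x, R ^ (-β) *
      (u x * singularIntegral β φ (R⁻¹ • (x - x₀)))) atTop (𝓝 (∫ _ : E, (0 : ℝ))) by
    rw [integral_zero] at this
    refine this.congr' ?_
    filter_upwards [eventually_gt_atTop 0] with R hR using (hrew R hR).symm
  refine tendsto_integral_filter_of_dominated_convergence
    (fun x => A * A' * (|u x| / (1 + ‖x‖ ^ β))) ?_ ?_ (hu.integrable.const_mul _) ?_
  · have hc := hu.continuous
    exact Eventually.of_forall fun R => Continuous.aestronglyMeasurable (by fun_prop)
  · filter_upwards [eventually_ge_atTop 1] with R hR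
    refine Eventually.of_forall fun x => (hbound R (by linarith) x).trans ?_
    have hRβ : 1 ≤ R ^ β := Real.one_le_rpow hR hβ0.le
    calc _ ≤ A * |u x| * (1 + ‖x - x₀‖ ^ β)⁻¹ := by gcongr
      _ ≤ A * |u x| * (A' * (1 + ‖x‖ ^ β)⁻¹) := by gcongr; exact hw x₀ x le_rfl
      _ = _ := by ring
  · refine Eventually.of_forall fun x => ?_
    have hlim : Tendsto (fun R : ℝ => A * |u x| * (R ^ β)⁻¹) atTop (𝓝 0) := by
      simpa using ((tendsto_rpow_atTop hβ0).inv_tendsto_atTop).const_mul (A * |u x|)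
    refine squeeze_zero_norm' ?_ hlim
    filter_upwards [eventually_gt_atTop 0] with R hR
    refine (hbound R hR x).trans ?_
    have : 0 ≤ ‖x - x₀‖ ^ β := by positivity
    gcongr
    linarith

end Duality

/-! ### The fractional Laplacian of a classical solution -/

section ClassicalSolutions

variable {n : ℕ}

theorem LocHolder.holderDiff {k : ℕ} {γ : ℝ≥0} {u : EuclideanSpace ℝ (Fin n) → ℝ}
    (h : LocHolder k γ u) : HolderDiff k γ u := by
  refine ⟨h.1, fun ρ => ?_⟩
  obtain ⟨C, hC⟩ := h.2 _ (isCompact_closedBall 0 ρ)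
  refine ⟨C, C.coe_nonneg, fun x y hx hy => ?_⟩
  simpa [dist_eq_norm] using
    hC.dist_le (mem_closedBall_zero_iff.2 hx) (mem_closedBall_zero_iff.2 hy)

variable [NeZero n]

/-- On a function of class `C^{2m+[α],{α}+ε}_loc` in the weighted space, the fractional Laplacian
with `0 < α < 2` is of class `C^{2m}` and its means vanish at large scales. -/
theorem contDiff_vanishingMeans_fracLaplacian {m : ℕ} {α : ℝ} (hα0 : 0 < α) (hα2 : α < 2)
    {u : EuclideanSpace ℝ (Fin n) → ℝ} (hu : ClassicalRegularity m α u) :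
    ContDiff ℝ (2 * m : ℕ) (fracLaplacian α u) ∧ VanishingMeans (fracLaplacian α u) := by
  obtain ⟨hw, ε, hε, hε1, hh⟩ := hu.2 hα2
  have hfr := Int.fract_nonneg α
  have hγ0 : 0 ≤ Int.fract α + ε := by linarith
  have hd := hh.holderDiff
  rw [Real.coe_toNNReal _ hγ0] at hd
  have hfloor : (⌊α⌋₊ : ℝ) + (Int.fract α + ε) = α + ε := by
    rw [natCast_floor_eq_intCast_floor hα0.le, ← add_assoc, Int.floor_add_fract]
  have ha : ⌊α⌋₊ ≤ 1 := Nat.lt_succ_iff.1 ((Nat.floor_lt hα0.le).2 (by exact_mod_cast hα2))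
  have hdim : finrank ℝ (EuclideanSpace ℝ (Fin n)) = n := finrank_euclideanSpace_fin
  set β : ℝ := n + α with hβ
  have hβ1 : (finrank ℝ (EuclideanSpace ℝ (Fin n)) : ℝ) < β := by rw [hdim]; linarith
  have hβs : β < finrank ℝ (EuclideanSpace ℝ (Fin n)) + (⌊α⌋₊ + (Int.fract α + ε)) := by
    rw [hdim, hfloor]; linarith
  have hβ2 : β < finrank ℝ (EuclideanSpace ℝ (Fin n)) + 2 := by rw [hdim]; linarith
  have hdom : NonlocalDomain β (⌊α⌋₊ + (Int.fract α + ε)) u :=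
    ⟨hd.1.continuous, hw, hd.secondDiffBound ha hγ0 hε1⟩
  have heq : fracLaplacian α u = fun x => fracConst n α * (singularIntegral β u x / 2) := by
    ext x
    rw [fracLaplacian, if_neg hα2.ne, fracLaplacianPV,
      (hdom.tendsto_truncated hβ1 hβs x).limUnder_eq]
  have hsm : ContDiff ℝ (2 * m : ℕ) (singularIntegral β u) :=
    contDiff_singularIntegral ha hβ1 hγ0 hε1 hβs hd hw
  rw [heq]
  refine ⟨contDiff_const.mul (hsm.div_const 2), fun φ hφ hφs x₀ => ?_⟩
  have := (hdom.vanishingMeans_singularIntegral hβ1 hβs hβ2 φ hφ hφs x₀).const_mul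
    (fracConst n α / 2)
  rw [mul_zero] at this
  refine this.congr fun R => ?_
  rw [← integral_const_mul]
  congr 1 with z
  ring

end ClassicalSolutions

end

end SuperPolyharmonic

theorem theorem1p1 {n : ℕ} [NeZero n] (hn : 2 ≤ n) (m : ℕ) (hm : 1 ≤ m)
    (α σ p q : ℝ) (hα0 : 0 < α) (hα2 : α ≤ 2) (hσ : σ < n) (hq : 0 < q) (hp : 0 < p)
    (hp1 : α = 2 → 1 ≤ p) (u : EuclideanSpace ℝ (Fin n) → ℝ)
    (hu : SuperPolyharmonic.IsNonnegClassicalSolution m α σ p q u) :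
    ∀ i : ℕ, i ≤ m - 1 → ∀ x : EuclideanSpace ℝ (Fin n),
      0 ≤ SuperPolyharmonic.higherFracLaplacian i α u x := by
  have hreg : ContDiff ℝ (2 * m : ℕ) (SuperPolyharmonic.fracLaplacian α u) ∧
      SuperPolyharmonic.VanishingMeans (SuperPolyharmonic.fracLaplacian α u) := by
    rcases hα2.lt_or_eq with h | h
    · exact SuperPolyharmonic.contDiff_vanishingMeans_fracLaplacian hα0 h hu.regular
    · have hc := hu.regular.1 h
      have heq : SuperPolyharmonic.fracLaplacian α u = SuperPolyharmonic.negLaplacian u := if_pos h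
      rw [heq]
      exact ⟨(SuperPolyharmonic.contDiff_laplacian hc).neg,
        (SuperPolyharmonic.vanishingMeans_of_integrable_rpow hc.continuous
          (by rwa [finrank_euclideanSpace_fin]) (hp1 h) hu.conv_finite).neg_laplacian
          (hc.of_le (by norm_cast; omega))⟩
  intro i hi
  refine hreg.2.iterate_negLaplacian_nonneg hreg.1 (fun x => ?_) (hi.trans (Nat.sub_le m 1))
  have := hu.eqn x
  rw [SuperPolyharmonic.higherFracLaplacian] at this
  rw [this]
  exact mul_nonneg (MeasureTheory.integral_nonneg fun y => by positivity)
    (Real.rpow_nonneg (hu.nonneg x) q)
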